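/- Let $H$ be a separable infinite-dimensional complex Hilbert space, and let $\mathrm{SA}(H)$ be the set of all (possibly unbounded, densely defined) self-adjoint operators on $H$. Equip $\mathrm{SA}(H)$ with the strong resolvent topology (SRT), the weakest topology for which the map $A\mapsto (A-i)^{-1}\xi\in H$ is continuous for every $\xi\in H$. For $A \in \mathrm{SA}(H)$ let $(e^{itA})_{t\in\mathbb{R}}$ be the strongly continuous one-parameter unitary group generated by $A$. Let $\{\xi_n\}_{n=1}^{\infty}$ be any complete orthonormal system of $H$, and put \[d(A,B):=\sum_{n=1}^{\infty}\sum_{m=1}^{\infty}\frac{1}{2^{n+m}}\sup_{t\in[-m,m]}\|e^{itA}\xi_n-e^{itB}\xi_n\|,\qquad A,B\in \mathrm{SA}(H).\] Then $d$ is a complete metric on $\mathrm{SA}(H)$ which induces the SRT, and $\mathrm{SA}(H)$ with the SRT is separable. Consequently, $\mathrm{SA}(H)$ with the SRT is a Polish space. -/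

import Mathlib

/-- The set `SA(H)` of all (possibly unbounded) self-adjoint operators on `H`. Self-adjointness
`A† = A` of a partially defined operator includes density of its domain
(`IsSelfAdjoint.dense_domain`). -/
@[ext]
structure SelfAdjointOp (H : Type*) [NormedAddCommGroup H] [InnerProductSpace ℂ H]
    [CompleteSpace H] where
  /-- The underlying operator, with its domain. -/
  toLinearPMap : H →ₗ.[ℂ] H
  isSelfAdjoint : IsSelfAdjoint toLinearPMap

namespace SelfAdjointOp

variable {H : Type*} [NormedAddCommGroup H] [InnerProductSpace ℂ H] [CompleteSpace H]

theorem inner_symm (A : SelfAdjointOp H) (x y : A.1.domain) :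
    inner ℂ (A.1 x) (y : H) = inner ℂ (x : H) (A.1 y) := by
  have h := LinearPMap.adjoint_isFormalAdjoint A.2.dense_domain
  rw [LinearPMap.isSelfAdjoint_def.1 A.2] at h
  exact h x y

theorem mem_graph_of_inner (A : SelfAdjointOp H) (y w : H)
    (h : ∀ x : A.1.domain, inner ℂ w (x : H) = inner ℂ y (A.1 x)) : (y, w) ∈ A.1.graph := by
  have hy := LinearPMap.mem_adjoint_domain_of_exists (T := A.1) y ⟨w, h⟩
  have hw := LinearPMap.adjoint_apply_eq A.2.dense_domain ⟨y, hy⟩ h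
  rw [← LinearPMap.isSelfAdjoint_def.1 A.2, LinearPMap.mem_graph_iff]
  exact ⟨⟨y, hy⟩, rfl, hw⟩

theorem im_inner_self (A : SelfAdjointOp H) (x : A.1.domain) :
    (inner ℂ (x : H) (A.1 x)).im = 0 := by
  have h1 := A.inner_symm x x
  have h2 := inner_conj_symm (𝕜 := ℂ) (x : H) (A.1 x)
  rw [h1] at h2
  exact Complex.conj_eq_iff_im.1 h2

theorem norm_le_sub (A : SelfAdjointOp H) (z : ℂ) (x : A.1.domain) :
    |z.im| * ‖(x : H)‖ ≤ ‖A.1 x - z • (x : H)‖ := by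
  rcases eq_or_ne (x : H) 0 with h0 | h0
  · simp [h0]
  have h : (inner ℂ (x : H) (A.1 x - z • (x : H))).im = -z.im * ‖(x : H)‖ ^ 2 := by
    rw [inner_sub_right, inner_smul_right, Complex.sub_im, A.im_inner_self,
      inner_self_eq_norm_sq_to_K]
    simp [← Complex.ofReal_pow]
  have h1 := (Complex.abs_im_le_norm _).trans (norm_inner_le_norm (𝕜 := ℂ) (x : H)
    (A.1 x - z • (x : H)))
  rw [h, abs_mul, abs_neg, abs_of_nonneg (sq_nonneg ‖(x : H)‖)] at h1
  have := norm_pos_iff.2 h0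
  nlinarith

theorem existsUnique_resolvent (A : SelfAdjointOp H) {z : ℂ} (hz : z.im ≠ 0) (ξ : H) :
    ∃! x : A.1.domain, A.1 x - z • (x : H) = ξ := by
  have hpos : 0 < |z.im| := abs_pos.2 hz
  let T : A.1.domain →ₗ[ℂ] H := A.1.toFun - z • A.1.domain.subtype
  have hT : ∀ x, T x = A.1 x - z • (x : H) := fun x => rfl
  have hbd : ∀ x : A.1.domain, ‖(x : H)‖ ≤ |z.im|⁻¹ * ‖T x‖ := fun x => by
    rw [inv_mul_eq_div, le_div_iff₀' hpos]; exact A.norm_le_sub z x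
  have huniq : ∀ x y, T x = T y → x = y := fun x y hxy => by
    have := hbd (x - y)
    rw [map_sub, hxy, sub_self, norm_zero, mul_zero] at this
    have h2 : (x : H) - y = 0 := norm_le_zero_iff.1 this
    exact Subtype.ext (sub_eq_zero.1 h2)
  have hclosed : IsClosed (LinearMap.range T : Set H) := by
    refine IsSeqClosed.isClosed fun u η hu hη => ?_
    choose x hx using hu
    have hc : CauchySeq fun n => (x n : H) := by
      have huc := Metric.cauchySeq_iff.1 hη.cauchySeq
      refine Metric.cauchySeq_iff.2 fun ε hε => ?_
      obtain ⟨N, hN⟩ := huc (|z.im| * ε) (by positivity)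
      refine ⟨N, fun m hm n hn => ?_⟩
      have h1 := hN m hm n hn
      have h2 := A.norm_le_sub z (x m - x n)
      rw [← hT, map_sub, hx, hx, ← dist_eq_norm] at h2
      have h3 : ‖((x m - x n : A.1.domain) : H)‖ = dist (x m : H) (x n) := by
        rw [dist_eq_norm]; rfl
      rw [h3] at h2
      exact lt_of_mul_lt_mul_left (h2.trans_lt h1) hpos.le
    obtain ⟨y, hy⟩ := cauchySeq_tendsto_of_complete hc
    have hAx : Filter.Tendsto (fun n => ((x n : H), A.1 (x n))) Filter.atTop
        (nhds (y, η + z • y)) := by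
      refine hy.prodMk_nhds ?_
      refine (hη.add (hy.const_smul z)).congr fun n => ?_
      rw [← hx, hT]; abel
    have hmem := IsClosed.mem_of_tendsto A.2.isClosed hAx
      (Filter.Eventually.of_forall fun n => LinearPMap.mem_graph A.1 (x n))
    obtain ⟨w, hw1, hw2⟩ := (LinearPMap.mem_graph_iff A.1).1 hmem
    exact ⟨w, by rw [hT, hw2, hw1]; simp⟩
  have hdense : (LinearMap.range T)ᗮ = ⊥ := by
    refine (Submodule.eq_bot_iff _).2 fun ζ hζ => ?_
    have hg := A.mem_graph_of_inner ζ ((starRingEnd ℂ z) • ζ) fun x => by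
      have := Submodule.inner_left_of_mem_orthogonal (LinearMap.mem_range_self T x) hζ
      rw [hT, inner_sub_right, inner_smul_right, sub_eq_zero] at this
      rw [inner_smul_left, Complex.conj_conj, this]
    obtain ⟨w, hw1, hw2⟩ := (LinearPMap.mem_graph_iff A.1).1 hg
    have := A.norm_le_sub (starRingEnd ℂ z) w
    rw [hw2, hw1] at this
    simp only [Complex.conj_im, abs_neg, sub_self, norm_zero] at this
    exact norm_le_zero_iff.1 (nonpos_of_mul_nonpos_right this hpos)
  have htop : LinearMap.range T = ⊤ := by
    have : CompleteSpace (LinearMap.range T) := hclosed.completeSpace_coe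
    exact (Submodule.orthogonal_eq_bot_iff).1 hdense
  obtain ⟨x, hx⟩ := LinearMap.range_eq_top.1 htop ξ
  exact ⟨x, hx, fun y hy => huniq _ _ (by rw [hx]; exact hy)⟩

/-- The resolvent `(A - z)⁻¹`, for `z` off the real axis, as a bounded operator on `H`. -/
noncomputable def resolvent (A : SelfAdjointOp H) {z : ℂ} (hz : z.im ≠ 0) : H →L[ℂ] H :=
  LinearMap.mkContinuous
    { toFun := fun ξ => ((A.existsUnique_resolvent hz ξ).choose : H)
      map_add' := fun ξ η => by
        have h1 := (A.existsUnique_resolvent hz ξ).choose_spec.1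
        have h2 := (A.existsUnique_resolvent hz η).choose_spec.1
        have h3 := (A.existsUnique_resolvent hz (ξ + η)).choose_spec.2
        rw [← h3 ((A.existsUnique_resolvent hz ξ).choose +
          (A.existsUnique_resolvent hz η).choose), Submodule.coe_add]
        dsimp only at h1 h2 ⊢
        conv_rhs => rw [← h1, ← h2]
        rw [LinearPMap.map_add, Submodule.coe_add, smul_add]; abel
      map_smul' := fun c ξ => by
        have h1 := (A.existsUnique_resolvent hz ξ).choose_spec.1
        have h3 := (A.existsUnique_resolvent hz (c • ξ)).choose_spec.2
        rw [← h3 (c • (A.existsUnique_resolvent hz ξ).choose), Submodule.coe_smul]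
        · rfl
        dsimp only at h1 ⊢
        conv_rhs => rw [← h1]
        rw [LinearPMap.map_smul, Submodule.coe_smul, smul_sub, smul_comm] }
    |z.im|⁻¹ fun ξ => by
      rw [inv_mul_eq_div, le_div_iff₀' (abs_pos.2 hz)]
      refine (A.norm_le_sub z _).trans (le_of_eq ?_)
      exact congrArg norm (A.existsUnique_resolvent hz ξ).choose_spec.1

theorem resolvent_spec (A : SelfAdjointOp H) {z : ℂ} (hz : z.im ≠ 0) (ξ : H) :
    ∃ x : A.1.domain, (x : H) = A.resolvent hz ξ ∧ A.1 x - z • (x : H) = ξ :=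
  ⟨(A.existsUnique_resolvent hz ξ).choose, rfl, (A.existsUnique_resolvent hz ξ).choose_spec.1⟩

theorem resolvent_apply_sub (A : SelfAdjointOp H) {z : ℂ} (hz : z.im ≠ 0) (x : A.1.domain) :
    A.resolvent hz (A.1 x - z • (x : H)) = x := by
  obtain ⟨y, hy1, hy2⟩ := A.resolvent_spec hz (A.1 x - z • (x : H))
  rw [← hy1, (A.existsUnique_resolvent hz _).unique hy2 rfl]

theorem I_im_ne : Complex.I.im ≠ 0 := by simp

/-- The strong resolvent topology: the weakest topology for which `A ↦ (A - i)⁻¹ ξ` is continuous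
for every `ξ`. -/
noncomputable instance strongResolventTopology : TopologicalSpace (SelfAdjointOp H) :=
  ⨅ ξ : H, TopologicalSpace.induced (fun A : SelfAdjointOp H => A.resolvent I_im_ne ξ) inferInstance

theorem resolvent_adjoint (A : SelfAdjointOp H) {z : ℂ} (hz : z.im ≠ 0)
    (hz' : (starRingEnd ℂ z).im ≠ 0) : star (A.resolvent hz) = A.resolvent hz' := by
  rw [ContinuousLinearMap.star_eq_adjoint, eq_comm, ContinuousLinearMap.eq_adjoint_iff]
  intro ξ η
  obtain ⟨x, hx1, hx2⟩ := A.resolvent_spec hz' ξ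
  obtain ⟨y, hy1, hy2⟩ := A.resolvent_spec hz η
  rw [← hx1, ← hy1]
  nth_rewrite 1 [← hy2]
  rw [← hx2, inner_sub_left, inner_sub_right, inner_smul_left, inner_smul_right, A.inner_symm,
    Complex.conj_conj]


theorem resolvent_commute (A : SelfAdjointOp H) {z w : ℂ} (hz : z.im ≠ 0) (hw : w.im ≠ 0) :
    Commute (A.resolvent hz) (A.resolvent hw) := by
  have key : ∀ {z w : ℂ} (hz : z.im ≠ 0) (hw : w.im ≠ 0) (ξ : H),
      A.resolvent hz ξ - A.resolvent hw ξ = (z - w) • A.resolvent hz (A.resolvent hw ξ) := by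
    intro z w hz hw ξ
    obtain ⟨y, hy1, hy2⟩ := A.resolvent_spec hw ξ
    have h := A.resolvent_apply_sub hz y
    rw [← hy1]
    nth_rewrite 1 [← hy2]
    have e : A.1 y - w • (y : H) = (A.1 y - z • (y : H)) + (z - w) • (y : H) := by
      rw [sub_smul]; abel
    rw [e, map_add, h, map_smul]; abel
  rcases eq_or_ne z w with rfl | hne
  · exact Commute.refl _
  ext ξ
  have h1 := key hz hw ξ
  have h2 := key hw hz ξ
  have h3 : (z - w) • A.resolvent hz (A.resolvent hw ξ)
      = (z - w) • A.resolvent hw (A.resolvent hz ξ) := by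
    rw [← h1, ← neg_sub w z, neg_smul, ← h2, neg_sub]
  exact smul_right_injective H (sub_ne_zero.2 hne) h3

theorem I_conj_im_ne : (starRingEnd ℂ Complex.I).im ≠ 0 := by simp

theorem resolvent_isStarNormal (A : SelfAdjointOp H) : IsStarNormal (A.resolvent I_im_ne) :=
  ⟨by rw [A.resolvent_adjoint I_im_ne I_conj_im_ne]; exact A.resolvent_commute _ _⟩

theorem spectrum_resolvent (A : SelfAdjointOp H) {z : ℂ}
    (hz : z ∈ spectrum ℂ (A.resolvent I_im_ne)) :
    z = 0 ∨ ∃ l : ℝ, z * (l - Complex.I) = 1 := by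
  have hn := A.resolvent_isStarNormal
  set R := A.resolvent I_im_ne with hR
  have hid : R - star R - (2 * Complex.I) • (star R * R) = 0 := by
    rw [hR, A.resolvent_adjoint I_im_ne I_conj_im_ne]
    ext ξ
    obtain ⟨y, hy1, hy2⟩ := A.resolvent_spec I_im_ne ξ
    have h := A.resolvent_apply_sub I_conj_im_ne y
    simp only [sub_apply, FunLike.coe_smul, Pi.smul_apply,
      mul_apply_eq_comp, zero_apply]
    rw [← hy1]
    have e : ξ = (A.1 y - (starRingEnd ℂ Complex.I) • (y : H)) - (2 * Complex.I) • (y : H) := by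
      rw [← hy2, Complex.conj_I, two_mul, add_smul, neg_smul]; abel
    nth_rewrite 1 [e]
    rw [map_sub, h, map_smul]; abel
  have hcfc : cfc (fun z : ℂ => z - star z - (2 * Complex.I) • (star z * z)) R
      = cfc (fun _ : ℂ => (0 : ℂ)) R := by
    rw [cfc_sub _ _ R, cfc_sub _ _ R, cfc_smul _ _ R, cfc_mul _ _ R, cfc_star_id (a := R),
      cfc_id' ℂ R, hid,
      cfc_const_zero ℂ R]
  have h0 := eqOn_of_cfc_eq_cfc (a := R) hcfc (hf := by fun_prop) (hg := by fun_prop) (ha := hn) hz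
  by_cases hz0 : z = 0
  · exact Or.inl hz0
  right
  have him : (z⁻¹).im = -1 := by
    have := congrArg Complex.im h0
    simp at this
    rw [Complex.inv_im, Complex.normSq_apply]
    have : z.re * z.re + z.im * z.im ≠ 0 := by
      rw [← Complex.normSq_apply]; simpa using hz0
    rw [div_eq_iff this]
    linarith
  refine ⟨(z⁻¹).re, ?_⟩
  have : ((z⁻¹).re : ℂ) - Complex.I = z⁻¹ := by
    apply Complex.ext <;> simp [-Complex.inv_re, -Complex.inv_im, him]
  rw [this, mul_inv_cancel₀ hz0]

/-- The function on the spectrum of `(A - i)⁻¹` corresponding to `l ↦ e^{itl} / (l - i)`. -/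
noncomputable def expFun (t : ℝ) (z : ℂ) : ℂ :=
  z * Complex.exp (Complex.I * t * (z⁻¹ + Complex.I))

theorem expFun_eq {t : ℝ} {z : ℂ} {l : ℝ} (h : z * (l - Complex.I) = 1) :
    expFun t z = z * Complex.exp (Complex.I * ((t * l : ℝ) : ℂ)) := by
  have : z⁻¹ = l - Complex.I := inv_eq_of_mul_eq_one_right h
  rw [expFun, this]
  push_cast; congr 2; ring

theorem norm_expFun (A : SelfAdjointOp H) (t : ℝ) {z : ℂ}
    (hz : z ∈ spectrum ℂ (A.resolvent I_im_ne)) : ‖expFun t z‖ = ‖z‖ := by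
  rcases A.spectrum_resolvent hz with rfl | ⟨l, hl⟩
  · simp [expFun]
  · rw [expFun_eq hl, norm_mul, mul_comm Complex.I, Complex.norm_exp_ofReal_mul_I, mul_one]

theorem continuousOn_expFun (A : SelfAdjointOp H) (t : ℝ) :
    ContinuousOn (expFun t) (spectrum ℂ (A.resolvent I_im_ne)) := by
  intro z hz
  by_cases hz0 : z = 0
  · subst hz0
    have h0 : expFun t 0 = 0 := by simp [expFun]
    rw [ContinuousWithinAt, h0, tendsto_zero_iff_norm_tendsto_zero]
    have h1 : Filter.Tendsto (fun z : ℂ => ‖z‖)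
        (nhdsWithin 0 (spectrum ℂ (A.resolvent I_im_ne))) (nhds 0) := by
      have := (continuous_norm (E := ℂ)).continuousWithinAt (x := 0)
        (s := spectrum ℂ (A.resolvent I_im_ne))
      rwa [ContinuousWithinAt, norm_zero] at this
    refine h1.congr' ?_
    filter_upwards [self_mem_nhdsWithin] with w hw
    exact (A.norm_expFun t hw).symm
  · refine ContinuousAt.continuousWithinAt ?_
    unfold expFun
    fun_prop (disch := assumption)

theorem norm_mul_le_one {z : ℂ} {l : ℝ} (h : z * (l - Complex.I) = 1) : ‖z‖ * |l| ≤ 1 := by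
  have h1 : ‖z‖ * ‖(l : ℂ) - Complex.I‖ = 1 := by rw [← norm_mul, h, norm_one]
  have h2 : |l| ≤ ‖(l : ℂ) - Complex.I‖ := by
    simpa using Complex.abs_re_le_norm ((l : ℂ) - Complex.I)
  exact (mul_le_mul_of_nonneg_left h2 (norm_nonneg z)).trans h1.le

theorem norm_expFun_sub (A : SelfAdjointOp H) (s t : ℝ) {z : ℂ}
    (hz : z ∈ spectrum ℂ (A.resolvent I_im_ne)) : ‖expFun s z - expFun t z‖ ≤ |s - t| := by
  rcases A.spectrum_resolvent hz with rfl | ⟨l, hl⟩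
  · simp [expFun]
  · have e : expFun s z - expFun t z = z * (Complex.exp (Complex.I * ((t * l : ℝ) : ℂ)) *
        (Complex.exp (Complex.I * (((s - t) * l : ℝ) : ℂ)) - 1)) := by
      rw [expFun_eq hl, expFun_eq hl, mul_sub, ← Complex.exp_add, ← mul_add, ← Complex.ofReal_add,
        mul_one, ← mul_sub]
      congr 5; ring
    rw [e, norm_mul, norm_mul, mul_comm Complex.I, Complex.norm_exp_ofReal_mul_I, one_mul]
    have h1 := Real.norm_exp_I_mul_ofReal_sub_one_le (x := (s - t) * l)
    rw [Real.norm_eq_abs, abs_mul] at h1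
    calc _ ≤ ‖z‖ * (|s - t| * |l|) := by gcongr
      _ = |s - t| * (‖z‖ * |l|) := by ring
      _ ≤ |s - t| * 1 := by gcongr; exact norm_mul_le_one hl
      _ = _ := mul_one _

theorem norm_expFun_deriv (A : SelfAdjointOp H) (t : ℝ) {z : ℂ}
    (hz : z ∈ spectrum ℂ (A.resolvent I_im_ne)) :
    ‖expFun t z * z - z * z - (t * Complex.I) * (z * (1 + Complex.I * z))‖ ≤ 2 * t ^ 2 := by
  rcases A.spectrum_resolvent hz with rfl | ⟨l, hl⟩
  · simp [expFun]; positivity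
  · have h1 : 1 + Complex.I * z = z * l := by rw [← hl]; ring
    have e : expFun t z * z - z * z - (t * Complex.I) * (z * (1 + Complex.I * z)) =
        z * z * (Complex.exp (Complex.I * ((t * l : ℝ) : ℂ)) - 1
          - Complex.I * ((t * l : ℝ) : ℂ)) := by
      rw [h1, expFun_eq hl]; push_cast; ring
    rw [e, norm_mul, norm_mul]
    have h2 : ‖Complex.exp (Complex.I * ((t * l : ℝ) : ℂ)) - 1
        - Complex.I * ((t * l : ℝ) : ℂ)‖ ≤ 2 * (t * l) ^ 2 := by
      have hn : ‖Complex.I * ((t * l : ℝ) : ℂ)‖ = |t * l| := by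
        rw [norm_mul, Complex.norm_I, one_mul, Complex.norm_real, Real.norm_eq_abs]
      rcases le_total |t * l| 1 with h | h
      · have := Complex.norm_exp_sub_one_sub_id_le (hn.trans_le h)
        rw [hn, sq_abs] at this
        nlinarith [sq_nonneg (t * l)]
      · have h3 := Real.norm_exp_I_mul_ofReal_sub_one_le (x := t * l)
        rw [Real.norm_eq_abs] at h3
        refine (norm_sub_le _ _).trans ?_
        rw [hn, ← sq_abs (t * l)]
        nlinarith
    have h4 := norm_mul_le_one hl
    calc _ ≤ ‖z‖ * ‖z‖ * (2 * (t * l) ^ 2) := by gcongr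
      _ = 2 * t ^ 2 * (‖z‖ * |l|) ^ 2 := by rw [mul_pow, mul_pow, sq_abs]; ring
      _ ≤ 2 * t ^ 2 * 1 ^ 2 := by gcongr
      _ = _ := by ring

/-- `expRes A t` is the bounded operator `e^{itA} (A - i)⁻¹`. -/
noncomputable def expRes (A : SelfAdjointOp H) (t : ℝ) : H →L[ℂ] H :=
  cfc (expFun t) (A.resolvent I_im_ne)

theorem expRes_mul (A : SelfAdjointOp H) (s t : ℝ) :
    A.expRes s * A.expRes t = A.expRes (s + t) * A.resolvent I_im_ne := by
  have hn := A.resolvent_isStarNormal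
  unfold expRes
  nth_rewrite 4 [← cfc_id' ℂ (A.resolvent I_im_ne)]
  rw [← cfc_mul _ _ _ (A.continuousOn_expFun s) (A.continuousOn_expFun t),
    ← cfc_mul _ _ _ (A.continuousOn_expFun (s + t))]
  refine cfc_congr fun z hz => ?_
  rcases A.spectrum_resolvent hz with rfl | ⟨l, hl⟩
  · simp [expFun]
  · simp only [expFun_eq hl]
    have : Complex.exp (Complex.I * (((s + t) * l : ℝ) : ℂ)) =
      Complex.exp (Complex.I * ((s * l : ℝ) : ℂ)) * Complex.exp (Complex.I * ((t * l : ℝ) : ℂ)) := by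
      rw [← Complex.exp_add]; push_cast; ring_nf
    rw [this]; ring

theorem expRes_zero (A : SelfAdjointOp H) : A.expRes 0 = A.resolvent I_im_ne := by
  have hn := A.resolvent_isStarNormal
  unfold expRes
  nth_rewrite 2 [← cfc_id' ℂ (A.resolvent I_im_ne)]
  exact cfc_congr fun z _ => by simp [expFun]

theorem expRes_comm (A : SelfAdjointOp H) (t : ℝ) :
    A.expRes t * A.resolvent I_im_ne = A.resolvent I_im_ne * A.expRes t := by
  have h1 := A.expRes_mul t 0
  have h2 := A.expRes_mul 0 t
  rw [add_zero, A.expRes_zero] at h1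
  rw [zero_add, A.expRes_zero] at h2
  exact h2.symm

theorem norm_expRes (A : SelfAdjointOp H) (t : ℝ) (ξ : H) :
    ‖A.expRes t ξ‖ = ‖A.resolvent I_im_ne ξ‖ := by
  have hn := A.resolvent_isStarNormal
  have h : star (A.expRes t) * A.expRes t
      = star (A.resolvent I_im_ne) * A.resolvent I_im_ne := by
    unfold expRes
    rw [← cfc_star, ← cfc_mul _ _ _ (A.continuousOn_expFun t).star (A.continuousOn_expFun t)]
    conv_rhs => rw [← cfc_id' ℂ (A.resolvent I_im_ne)]
    rw [← cfc_star, ← cfc_mul _ _ _]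
    refine cfc_congr fun z hz => ?_
    have := A.norm_expFun t hz
    simp only [Complex.star_def, ← Complex.normSq_eq_conj_mul_self, Complex.normSq_eq_norm_sq, this]
  have h2 : ∀ T : H →L[ℂ] H, (inner ℂ ((star T * T) ξ) ξ : ℂ) = (‖T ξ‖ : ℂ) ^ 2 := fun T => by
    rw [ContinuousLinearMap.star_eq_adjoint, mul_apply_eq_comp,
      ContinuousLinearMap.adjoint_inner_left, inner_self_eq_norm_sq_to_K]; rfl
  have h3 := h2 (A.expRes t)
  rw [h, h2] at h3
  have h4 : ‖A.resolvent I_im_ne ξ‖ ^ 2 = ‖A.expRes t ξ‖ ^ 2 := by exact_mod_cast h3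
  exact ((sq_eq_sq₀ (norm_nonneg _) (norm_nonneg _)).1 h4).symm

theorem norm_expRes_sub (A : SelfAdjointOp H) (s t : ℝ) :
    ‖A.expRes s - A.expRes t‖ ≤ |s - t| := by
  unfold expRes
  rw [← cfc_sub _ _ _ (A.continuousOn_expFun s) (A.continuousOn_expFun t)]
  exact norm_cfc_le (abs_nonneg _) fun z hz => A.norm_expFun_sub s t hz

theorem norm_expRes_deriv (A : SelfAdjointOp H) (t : ℝ) :
    ‖A.expRes t * A.resolvent I_im_ne - A.resolvent I_im_ne * A.resolvent I_im_ne
      - (t * Complex.I) • (A.resolvent I_im_ne * (1 + Complex.I • A.resolvent I_im_ne))‖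
      ≤ 2 * t ^ 2 := by
  have hn := A.resolvent_isStarNormal
  have h : cfc (fun z : ℂ => expFun t z * z - z * z - (t * Complex.I) • (z * (1 + Complex.I • z)))
      (A.resolvent I_im_ne) = A.expRes t * A.resolvent I_im_ne
      - A.resolvent I_im_ne * A.resolvent I_im_ne
      - (t * Complex.I) • (A.resolvent I_im_ne * (1 + Complex.I • A.resolvent I_im_ne)) := by
    have hc := A.continuousOn_expFun t
    rw [cfc_sub _ _ _ (by fun_prop) (by fun_prop), cfc_sub _ _ _ (by fun_prop) (by fun_prop),
      cfc_mul _ _ _ (by fun_prop) (by fun_prop), cfc_mul _ _ _ (by fun_prop) (by fun_prop),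
      cfc_smul _ _ _ (by fun_prop), cfc_mul _ _ _ (by fun_prop) (by fun_prop),
      cfc_add _ _ _ (by fun_prop) (by fun_prop), cfc_smul _ _ _ (by fun_prop), cfc_id' ℂ _,
      cfc_const_one ℂ _]
    rfl
  rw [← h]
  exact norm_cfc_le (by positivity) fun z hz => by
    simpa only [smul_eq_mul] using A.norm_expFun_deriv t hz

theorem denseRange_resolvent (A : SelfAdjointOp H) {z : ℂ} (hz : z.im ≠ 0) :
    DenseRange (A.resolvent hz) :=
  A.2.dense_domain.mono fun x hx => ⟨_, A.resolvent_apply_sub hz ⟨x, hx⟩⟩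

/-- `U` is the strongly continuous one-parameter unitary group with generator `A`:
`U 0 = 1`, `U (s + t) = U s U t`, each orbit is continuous, and `ξ` belongs to the domain of `A` with
`A ξ = η` exactly when `t ↦ U t ξ` has the derivative `i η` at `0`. -/
structure IsUnitaryGroupOf (A : SelfAdjointOp H) (U : ℝ → H →L[ℂ] H) : Prop where
  mem_unitary : ∀ t, U t ∈ unitary (H →L[ℂ] H)
  map_zero : U 0 = 1
  map_add : ∀ s t, U (s + t) = U s * U t
  continuous : ∀ ξ, Continuous fun t => U t ξ
  mem_graph_iff : ∀ ξ η : H,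
    (ξ, η) ∈ A.1.graph ↔ HasDerivAt (fun t => U t ξ) (Complex.I • η) 0

theorem exists_unitaryGroup (A : SelfAdjointOp H) : ∃ U, A.IsUnitaryGroupOf U := by
  set R := A.resolvent I_im_ne with hR
  have hd : DenseRange R := A.denseRange_resolvent I_im_ne
  have hex : ∀ t, ∃ V : H →L[ℂ] H, ∀ ξ, V (R ξ) = A.expRes t ξ := fun t =>
    ⟨(A.expRes t).toLinearMap.extendOfNorm R.toLinearMap, fun ξ =>
      LinearMap.extendOfNorm_eq (f := (A.expRes t).toLinearMap) (e := R.toLinearMap) hd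
        ⟨1, fun x => by simpa using (A.norm_expRes t x).le⟩ ξ⟩
  choose U hU using hex
  have hnorm : ∀ t ξ, ‖U t ξ‖ = ‖ξ‖ := fun t ξ => by
    refine isClosed_property hd (p := fun ξ => ‖U t ξ‖ = ‖ξ‖) (isClosed_eq (by fun_prop)
      (by fun_prop)) (fun x => ?_) ξ
    rw [hU, A.norm_expRes]
  have hUR : ∀ t, U t * R = A.expRes t := fun t => by
    ext ξ; exact hU t ξ
  have hR2 : ∀ {S T : H →L[ℂ] H}, S * R = T * R → S = T := fun {S T} h => by
    refine DFunLike.coe_injective (hd.equalizer S.continuous T.continuous ?_)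
    funext ξ
    exact DFunLike.congr_fun h ξ
  have h0 : U 0 = 1 := hR2 (by rw [hUR, A.expRes_zero, one_mul])
  have hadd : ∀ s t, U (s + t) = U s * U t := fun s t => by
    refine hR2 (hR2 ?_)
    rw [hUR, ← A.expRes_mul, mul_assoc (U s), hUR, mul_assoc (U s), A.expRes_comm, ← mul_assoc, hUR]
  have hunit : ∀ t, U t ∈ unitary (H →L[ℂ] H) := fun t => by
    have hi : ∀ t, star (U t) * U t = 1 := fun t =>
      (ContinuousLinearMap.norm_map_iff_adjoint_comp_self (U t)).1 (hnorm t)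
    have h1 : U t * U (-t) = 1 := by rw [← hadd, add_neg_cancel, h0]
    refine Unitary.mem_iff.2 ⟨hi t, ?_⟩
    have : star (U t) = U (-t) := by
      rw [← mul_one (star (U t)), ← h1, ← mul_assoc, hi, one_mul]
    rw [this, h1]
  have hlip : ∀ s t ξ, ‖U s (R ξ) - U t (R ξ)‖ ≤ |s - t| * ‖ξ‖ := fun s t ξ => by
    rw [hU, hU, ← sub_apply]
    exact (ContinuousLinearMap.le_opNorm _ _).trans (by gcongr; exact A.norm_expRes_sub s t)
  have hcont : ∀ ξ, Continuous fun t => U t ξ := fun ξ => by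
    refine Metric.continuous_iff.2 fun t ε hε => ?_
    obtain ⟨ζ, hζ⟩ := Metric.denseRange_iff.1 hd ξ (ε / 3) (by positivity)
    rw [dist_eq_norm] at hζ
    refine ⟨ε / 3 / (‖ζ‖ + 1), by positivity, fun s hs => ?_⟩
    rw [Real.dist_eq, lt_div_iff₀ (by positivity)] at hs
    have h1 := hlip s t ζ
    have e : U s ξ - U t ξ = U s (ξ - R ζ) - U t (ξ - R ζ) + (U s (R ζ) - U t (R ζ)) := by
      rw [map_sub, map_sub]; abel
    rw [dist_eq_norm, e]
    have h2 := norm_add_le (U s (ξ - R ζ) - U t (ξ - R ζ)) (U s (R ζ) - U t (R ζ))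
    have h3 := norm_sub_le (U s (ξ - R ζ)) (U t (ξ - R ζ))
    rw [hnorm, hnorm] at h3
    nlinarith [abs_nonneg (s - t)]
  have hfwd : ∀ ξ η, (ξ, η) ∈ A.1.graph → HasDerivAt (fun t => U t ξ) (Complex.I • η) 0 := by
    intro ξ η hmem
    obtain ⟨x, hx1, hx2⟩ := (LinearPMap.mem_graph_iff A.1).1 hmem
    simp only at hx1 hx2
    set ζ := η - Complex.I • ξ with hζ
    have hRζ : R ζ = ξ := by
      have := A.resolvent_apply_sub I_im_ne x
      rwa [hx1, hx2] at this
    have hη : η = (1 + Complex.I • R) ζ := by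
      have : (1 + Complex.I • R) ζ = ζ + Complex.I • R ζ := rfl
      rw [this, hRζ, hζ]; abel
    rw [hasDerivAt_iff_isLittleO_nhds_zero]
    refine Asymptotics.isLittleO_iff.2 fun ε hε => ?_
    set C := 1 + ‖(1 + Complex.I • R : H →L[ℂ] H)‖ with hC
    have hCpos : 0 < C := by positivity
    obtain ⟨θ, hθ⟩ := Metric.denseRange_iff.1 hd ζ (ε / 2 / C) (by positivity)
    rw [dist_eq_norm, lt_div_iff₀ hCpos] at hθ
    have hpos : 0 < ε / 2 / (2 * ‖θ‖ + 1) := by positivity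
    filter_upwards [Metric.ball_mem_nhds (0 : ℝ) hpos] with t ht
    rw [mem_ball_zero_iff, Real.norm_eq_abs, lt_div_iff₀ (by positivity)] at ht
    rw [zero_add, h0, Real.norm_eq_abs, ← hRζ, hU, hη]
    have e : A.expRes t ζ - (1 : H →L[ℂ] H) (R ζ) - t • Complex.I • (1 + Complex.I • R) ζ
        = (A.expRes t * R - R * R - (t * Complex.I) • (R * (1 + Complex.I • R))) θ
          + ((A.expRes t - A.expRes 0) (ζ - R θ)
            - (t * Complex.I) • (1 + Complex.I • R) (ζ - R θ)) := by
      have e1 : (A.expRes t * R - R * R - (t * Complex.I) • (R * (1 + Complex.I • R))) θ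
          = A.expRes t (R θ) - R (R θ) - (t * Complex.I) • (R θ + Complex.I • R (R θ)) := by
        rw [mul_add, mul_one, mul_smul_comm]; rfl
      have e2 : ∀ v, (1 + Complex.I • R) v = v + Complex.I • R v := fun v => rfl
      have e3 : (1 : H →L[ℂ] H) (R ζ) = R ζ := rfl
      rw [e1, A.expRes_zero, ← hR, e2, e2, e3, sub_apply, ← smul_assoc t,
        Complex.real_smul]
      simp only [map_sub]
      module
    rw [e]
    have b1 := ((A.expRes t * R - R * R
      - (t * Complex.I) • (R * (1 + Complex.I • R))).le_opNorm θ).trans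
      (mul_le_mul_of_nonneg_right (A.norm_expRes_deriv t) (norm_nonneg θ))
    have b2 := ((A.expRes t - A.expRes 0).le_opNorm (ζ - R θ)).trans
      (mul_le_mul_of_nonneg_right (A.norm_expRes_sub t 0) (norm_nonneg _))
    have b3 : ‖((t : ℂ) * Complex.I) • (1 + Complex.I • R) (ζ - R θ)‖
        ≤ |t| * (‖(1 + Complex.I • R : H →L[ℂ] H)‖ * ‖ζ - R θ‖) := by
      rw [norm_smul, norm_mul, Complex.norm_I, mul_one, Complex.norm_real, Real.norm_eq_abs]
      gcongr
      exact ContinuousLinearMap.le_opNorm _ _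
    rw [sub_zero] at b2
    refine (norm_add_le _ _).trans ?_
    refine (add_le_add b1 ((norm_sub_le _ _).trans (add_le_add b2 b3))).trans ?_
    have c1 : |t| * ‖ζ - R θ‖ + |t| * (‖(1 + Complex.I • R : H →L[ℂ] H)‖ * ‖ζ - R θ‖)
        = |t| * (‖ζ - R θ‖ * C) := by rw [hC]; ring
    have c2 : 2 * t ^ 2 * ‖θ‖ = |t| * (|t| * (2 * ‖θ‖)) := by rw [← sq_abs]; ring
    rw [c1, c2, ← mul_add, mul_comm ε]
    refine mul_le_mul_of_nonneg_left ?_ (abs_nonneg t)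
    nlinarith [abs_nonneg t]
  refine ⟨U, hunit, h0, hadd, hcont, fun ξ η => ⟨hfwd ξ η, fun hder => ?_⟩⟩
  refine A.mem_graph_of_inner ξ η fun x => ?_
  have h1 := hder.inner ℂ (hfwd x (A.1 x) (A.1.mem_graph x))
  have h2 : (fun t => inner ℂ (U t ξ) (U t (x : H)) : ℝ → ℂ) = fun _ => inner ℂ ξ (x : H) := by
    funext t
    have := (Unitary.mem_iff.1 (hunit t)).1
    rw [← ContinuousLinearMap.adjoint_inner_left, ← ContinuousLinearMap.star_eq_adjoint,
      ← mul_apply_eq_comp, this]; rfl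
  rw [h2] at h1
  have h3 := h1.unique (hasDerivAt_const (0 : ℝ) _)
  rw [h0] at h3
  simp only [inner_smul_left, inner_smul_right, Complex.conj_I, one_apply_eq_self] at h3
  have h4 : Complex.I * (inner ℂ ξ (A.1 x) - inner ℂ η (x : H)) = 0 := by
    rw [← h3]; ring
  have h5 := (mul_eq_zero.1 h4).resolve_left Complex.I_ne_zero
  exact (sub_eq_zero.1 h5).symm

theorem IsUnitaryGroupOf.hasDerivAt {A : SelfAdjointOp H} {U : ℝ → H →L[ℂ] H}
    (hU : A.IsUnitaryGroupOf U) {ξ η : H} (h : (ξ, η) ∈ A.1.graph) (t : ℝ) :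
    HasDerivAt (fun s => U s ξ) (Complex.I • U t η) t ∧ (U t ξ, U t η) ∈ A.1.graph := by
  have h0 := (hU.mem_graph_iff ξ η).1 h
  have h1 : HasDerivAt (fun s => U t (U s ξ)) (Complex.I • U t η) 0 := by
    rw [← map_smul]
    exact ((U t).restrictScalars ℝ).hasFDerivAt.comp_hasDerivAt 0 h0
  constructor
  · have h2 : HasDerivAt (fun s => U t (U (s - t) ξ)) (Complex.I • U t η) t := by
      rw [← sub_self t] at h1
      exact h1.comp_sub_const t t
    refine h2.congr_of_eventuallyEq (Filter.Eventually.of_forall fun s => ?_)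
    change U s ξ = (U t * U (s - t)) ξ
    rw [← hU.map_add, add_sub_cancel]
  · refine (hU.mem_graph_iff _ _).2
      (h1.congr_of_eventuallyEq (Filter.Eventually.of_forall fun s => ?_))
    change (U s * U t) ξ = (U t * U s) ξ
    rw [← hU.map_add, ← hU.map_add, add_comm]

theorem IsUnitaryGroupOf.unique {A : SelfAdjointOp H} {U V : ℝ → H →L[ℂ] H}
    (hU : A.IsUnitaryGroupOf U) (hV : A.IsUnitaryGroupOf V) : U = V := by
  have key : ∀ x : A.1.domain, ∀ t, U t (x : H) = V t (x : H) := by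
    intro x
    have hder : ∀ t, HasDerivAt
        (fun s => (inner ℂ (U s (x : H) - V s (x : H)) (U s (x : H) - V s (x : H)) : ℂ)) 0 t := by
      intro t
      obtain ⟨hu1, hu2⟩ := hU.hasDerivAt (A.1.mem_graph x) t
      obtain ⟨hv1, hv2⟩ := hV.hasDerivAt (A.1.mem_graph x) t
      have hg := sub_mem hu2 hv2
      obtain ⟨y, hy1, hy2⟩ := (LinearPMap.mem_graph_iff A.1).1 hg
      simp only [Prod.mk_sub_mk] at hy1 hy2
      have hd := (hu1.sub hv1).inner ℂ (hu1.sub hv1)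
      refine hd.congr_deriv ?_
      simp only [Pi.sub_apply]
      rw [← smul_sub, ← hy1, ← hy2, inner_smul_left, inner_smul_right, A.inner_symm, Complex.conj_I]
      ring
    intro t
    have hc := is_const_of_deriv_eq_zero (fun t => (hder t).differentiableAt)
      (fun t => (hder t).deriv) t 0
    simp only [hU.map_zero, hV.map_zero, sub_self, inner_zero_left] at hc
    exact sub_eq_zero.1 (inner_self_eq_zero.1 hc)
  funext t
  refine DFunLike.coe_injective (Continuous.ext_on A.2.dense_domain (U t).continuous
    (V t).continuous fun ξ hξ => key ⟨ξ, hξ⟩ t)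

theorem existsUnique_unitaryGroup (A : SelfAdjointOp H) : ∃! U, A.IsUnitaryGroupOf U :=
  let ⟨U, hU⟩ := A.exists_unitaryGroup
  ⟨U, hU, fun _ hV => hV.unique hU⟩

/-- The unitary operators `e^{itA}`, `t ∈ ℝ`: the unique strongly continuous one-parameter unitary
group with generator `A`. -/
noncomputable def expI (A : SelfAdjointOp H) : ℝ → H →L[ℂ] H :=
  A.existsUnique_unitaryGroup.choose

theorem expI_spec (A : SelfAdjointOp H) : A.IsUnitaryGroupOf A.expI :=
  A.existsUnique_unitaryGroup.choose_spec.1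

/-- The distance
`d(A, B) = ∑_{n ≥ 1} ∑_{m ≥ 1} 2^{-(n+m)} sup_{t ∈ [-m, m]} ‖e^{itA} ξ_n - e^{itB} ξ_n‖`
attached to a complete orthonormal system `ξ_1, ξ_2, …`. Here `ξ_{n+1}` is `b n`, and the summation
indices are shifted by one so that they start at `0`. -/
noncomputable def expDist (b : HilbertBasis ℕ ℂ H) (A B : SelfAdjointOp H) : ℝ :=
  ∑' n : ℕ, ∑' m : ℕ, (1 / 2 ^ ((n + 1) + (m + 1)) : ℝ) *
    ⨆ t : Set.Icc (-((m + 1 : ℕ) : ℝ)) ((m + 1 : ℕ) : ℝ), ‖A.expI t (b n) - B.expI t (b n)‖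

end SelfAdjointOp

/-!
The metric and the topology meet in the following notion: along a filter, `e^{itA_i} ξ - e^{itB_i} ξ`
tends to `0` uniformly for `t` in bounded sets. The vectors `ξ` with this property form a closed
subspace (`locUnifClose`), so by dominated convergence of the defining series, `expDist b` tends to
`0` exactly when this subspace is all of `H` (`tendsto_expDist_iff`).

*The metric induces the strong resolvent topology.* If the unitary groups converge, then so do the
resolvents, by dominated convergence in `(A - i)⁻¹ = i ∫_0^∞ e^{-s} e^{-isA} ds`
(`tendsto_resolvent_of_locUnifClose`). Conversely, put
`e(t) = (A - i)⁻¹ e^{itB} (B - i)⁻¹ ξ - e^{itA} (A - i)⁻¹ (B - i)⁻¹ ξ`. It satisfies `e(0) = 0` and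
`e' = i A e + i f` with `f(t) = ((A - i)⁻¹ - (B - i)⁻¹) e^{itB} ξ`. As `A` is symmetric, only `f`
contributes to the derivative of `‖e‖ ^ 2`, and `f` is uniformly small on bounded intervals because
strong convergence of contractions is uniform on compact sets. Hence `e^{itA}` is close to `e^{itB}`
on the dense range of `(B - i)⁻²` (`locUnifClose_of_tendsto_resolvent`).

*The metric is complete.* For a Cauchy sequence the unitary groups converge pointwise, locally
uniformly in `t`, to a strongly continuous unitary group (`exists_locUnifClose_of_cauchy`). By Stone's
theorem (`IsUnitaryGroup.exists_isUnitaryGroupOf`) the limit has a self-adjoint generator. Stone's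
theorem is proved by differentiating the Laplace transforms of `U (-s) ξ` and `U s ξ`; this
shows that the generator `A`, which is symmetric, has `A - i` and `A + i` surjective.

*Separability.* Resolvents at `i` are contractions, so the strong resolvent topology is induced by
`A ↦ ((A - i)⁻¹ v_n)_n` for a dense sequence `v`. It is therefore second countable, as a topology
induced from `ℕ → H`.
-/

namespace SelfAdjointOp

open Filter Topology

variable {H : Type*} [NormedAddCommGroup H] [InnerProductSpace ℂ H] [CompleteSpace H]

/-! ### Operators given by symmetric graphs -/

theorem ext_graph {A B : SelfAdjointOp H} (h : A.1.graph = B.1.graph) : A = B :=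
  SelfAdjointOp.ext (LinearPMap.eq_of_eq_graph h)

/-- The basic criterion for self-adjointness, in terms of graphs: a symmetric operator `T` for which
`T - i` and `T + i` are surjective is self-adjoint. The density of its domain is not assumed, but
follows from the surjectivity of `T - i`. -/
theorem exists_of_symmetric_graph (G : Submodule ℂ (H × H))
    (hsv : ∀ p ∈ G, p.1 = 0 → p.2 = 0)
    (hsymm : ∀ p ∈ G, ∀ q ∈ G, inner ℂ p.2 q.1 = inner ℂ p.1 q.2)
    (hminus : ∀ ξ : H, ∃ x : H, (x, ξ + Complex.I • x) ∈ G)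
    (hplus : ∀ ξ : H, ∃ x : H, (x, ξ - Complex.I • x) ∈ G) :
    ∃ A : SelfAdjointOp H, A.1.graph = G := by
  set T := G.toLinearPMap with hT
  have hTG : T.graph = G := G.toLinearPMap_graph_eq hsv
  have hmem : ∀ x : T.domain, ((x : H), T x) ∈ G := fun x => hTG ▸ T.mem_graph x
  have hdense : Dense (T.domain : Set H) := by
    rw [Submodule.dense_iff_topologicalClosure_eq_top, Submodule.topologicalClosure_eq_top_iff,
      Submodule.eq_bot_iff]
    intro η hη
    obtain ⟨x, hx⟩ := hminus η
    have hxd : x ∈ T.domain := by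
      rw [← hTG] at hx
      exact LinearPMap.mem_domain_of_mem_graph hx
    have h1 : inner ℂ η x = 0 := Submodule.inner_left_of_mem_orthogonal hxd hη
    have h2 : inner ℂ x η = 0 := Submodule.inner_right_of_mem_orthogonal hxd hη
    have h3 := hsymm _ hx _ hx
    simp only [inner_add_left, inner_add_right, inner_smul_left, inner_smul_right, h1, h2,
      Complex.conj_I, zero_add] at h3
    have h4 : (2 * Complex.I) * inner ℂ x x = 0 := by linear_combination -h3
    have h5 : x = 0 := by simpa using h4
    subst h5
    simpa using hsv _ hx rfl
  have hle : T ≤ T.adjoint := LinearPMap.IsFormalAdjoint.le_adjoint hdense fun x y =>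
    hsymm _ (hmem x) _ (hmem y)
  have hdom : T.domain = T.adjoint.domain := by
    refine le_antisymm hle.1 fun y hy => ?_
    obtain ⟨x, hx⟩ := hminus (T.adjoint ⟨y, hy⟩ - Complex.I • y)
    have hxd : x ∈ T.domain := by
      rw [← hTG] at hx
      exact LinearPMap.mem_domain_of_mem_graph hx
    obtain ⟨q, hq⟩ := hplus (y - x)
    have hq' := hq
    rw [← hTG] at hq'
    obtain ⟨q', rfl, hq2⟩ := (LinearPMap.mem_graph_iff T).1 hq'
    have h1 : inner ℂ (T.adjoint ⟨y, hy⟩) (q' : H) = inner ℂ y (T q') :=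
      LinearPMap.adjoint_isFormalAdjoint hdense ⟨y, hy⟩ q'
    have h2 := hsymm _ hx _ hq
    simp only at h2 hq2
    rw [hq2] at h1
    have h3 : inner ℂ (y - x) (y - x) = 0 := by
      simp only [inner_add_left, inner_sub_left, inner_sub_right, inner_smul_left,
        inner_smul_right, Complex.conj_I] at h1 h2 ⊢
      linear_combination h2 - h1
    rw [inner_self_eq_zero, sub_eq_zero] at h3
    rwa [h3]
  refine ⟨⟨T, ?_⟩, hTG⟩
  rw [LinearPMap.isSelfAdjoint_def]
  exact (LinearPMap.eq_of_le_of_domain_eq hle hdom).symm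

/-! ### Stone's theorem -/

/-- A strongly continuous one-parameter unitary group, with no reference to a generator. -/
structure IsUnitaryGroup (U : ℝ → H →L[ℂ] H) : Prop where
  mem_unitary : ∀ t, U t ∈ unitary (H →L[ℂ] H)
  map_zero : U 0 = 1
  map_add : ∀ s t, U (s + t) = U s * U t
  continuous : ∀ ξ, Continuous fun t => U t ξ

theorem IsUnitaryGroupOf.isUnitaryGroup {A : SelfAdjointOp H} {U : ℝ → H →L[ℂ] H}
    (h : A.IsUnitaryGroupOf U) : IsUnitaryGroup U :=
  ⟨h.mem_unitary, h.map_zero, h.map_add, h.continuous⟩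

namespace IsUnitaryGroup

variable {U : ℝ → H →L[ℂ] H}

theorem norm_apply (hU : IsUnitaryGroup U) (t : ℝ) (ξ : H) : ‖U t ξ‖ = ‖ξ‖ :=
  (ContinuousLinearMap.norm_map_iff_adjoint_comp_self (U t)).2
    (Unitary.mem_iff.1 (hU.mem_unitary t)).1 ξ

theorem inner_apply (hU : IsUnitaryGroup U) (t : ℝ) (ξ η : H) :
    inner ℂ (U t ξ) (U t η) = inner ℂ ξ η := by
  rw [← ContinuousLinearMap.adjoint_inner_left, ← ContinuousLinearMap.star_eq_adjoint,
    ← mul_apply_eq_comp, (Unitary.mem_iff.1 (hU.mem_unitary t)).1]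
  rfl

/-- The time-reversed group, whose generator is the negative of that of `U`. -/
theorem comp_neg (hU : IsUnitaryGroup U) : IsUnitaryGroup fun t => U (-t) where
  mem_unitary t := hU.mem_unitary (-t)
  map_zero := by rw [neg_zero, hU.map_zero]
  map_add s t := by rw [neg_add, hU.map_add]
  continuous ξ := (hU.continuous ξ).comp continuous_neg

/-- The graph of the generator of a one-parameter group `U`: the pairs `(ξ, η)` such that
`t ↦ U t ξ` has the derivative `i η` at `0`. -/
def generatorGraph (U : ℝ → H →L[ℂ] H) : Submodule ℂ (H × H) where
  carrier := {p | HasDerivAt (fun t => U t p.1) (Complex.I • p.2) 0}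
  add_mem' {p q} hp hq := by
    have h := HasDerivAt.add hp hq
    simpa [Pi.add_def] using h
  zero_mem' := by simpa using hasDerivAt_const (0 : ℝ) (0 : H)
  smul_mem' c p hp := by
    have h := HasDerivAt.const_smul c hp
    simpa [Pi.smul_def, smul_comm c] using h

omit [CompleteSpace H] in
theorem mem_generatorGraph {ξ η : H} : (ξ, η) ∈ generatorGraph U ↔
    HasDerivAt (fun t => U t ξ) (Complex.I • η) 0 := Iff.rfl

theorem continuous_exp_neg_smul (hU : IsUnitaryGroup U) (ξ : H) :
    Continuous fun s => Real.exp (-s) • U (-s) ξ :=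
  (Real.continuous_exp.comp continuous_neg).smul (hU.comp_neg.continuous ξ)

theorem norm_exp_neg_smul (hU : IsUnitaryGroup U) (ξ : H) (s : ℝ) :
    ‖Real.exp (-s) • U (-s) ξ‖ = Real.exp (-s) * ‖ξ‖ := by
  rw [norm_smul, hU.norm_apply, Real.norm_eq_abs, Real.abs_exp]

theorem integrableOn_exp_neg_smul (hU : IsUnitaryGroup U) (ξ : H) (a : ℝ) :
    MeasureTheory.IntegrableOn (fun s => Real.exp (-s) • U (-s) ξ) (Set.Ioi a) :=
  ((integrableOn_exp_neg_Ioi a).mul_const ‖ξ‖).mono'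
    (hU.continuous_exp_neg_smul ξ).aestronglyMeasurable
    (Filter.Eventually.of_forall fun s => (hU.norm_exp_neg_smul ξ s).le)

/-- The Laplace transform `∫_0^∞ e^{-s} U (-s) ξ ds`, which is `(1 + iA)⁻¹ ξ = -i (A - i)⁻¹ ξ` if `A`
is the generator of `U`. -/
noncomputable def laplace (U : ℝ → H →L[ℂ] H) (ξ : H) : H :=
  ∫ s in Set.Ioi (0 : ℝ), Real.exp (-s) • U (-s) ξ

/-- Translating the variable of integration turns the action of `U h` into a change of the lower
limit from `0` to `-h`. -/
theorem apply_laplace (hU : IsUnitaryGroup U) (ξ : H) (h : ℝ) :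
    U h (laplace U ξ) = Real.exp (-h) • (laplace U ξ
      - ∫ s in (0 : ℝ)..(-h), Real.exp (-s) • U (-s) ξ) := by
  have hi := hU.integrableOn_exp_neg_smul ξ
  have h1 : U h (laplace U ξ)
      = ∫ s in Set.Ioi (0 : ℝ), Real.exp (-h) • (Real.exp (-(s - h)) • U (-(s - h)) ξ) := by
    rw [laplace, ← ContinuousLinearMap.integral_comp_comm _ (hi 0)]
    refine MeasureTheory.integral_congr_ae (Filter.Eventually.of_forall fun s => ?_)
    simp only
    rw [smul_smul, ← Real.exp_add, neg_sub, sub_eq_add_neg h s, hU.map_add]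
    simp [mul_apply_eq_comp]
  have h2 := (MeasureTheory.measurePreserving_sub_right MeasureTheory.volume
    h).setIntegral_preimage_emb (Homeomorph.subRight h).measurableEmbedding
    (fun s => Real.exp (-s) • U (-s) ξ) (Set.Ioi (-h))
  rw [h1, MeasureTheory.integral_smul]
  congr 1
  have h3 : (fun x : ℝ => x - h) ⁻¹' Set.Ioi (-h) = Set.Ioi 0 := by
    ext x; simp
  rw [h3] at h2
  rw [h2, laplace, ← intervalIntegral.integral_interval_add_Ioi (hi 0) (hi (-h))]
  abel

/-- The generator `A` satisfies `(A - i) x = ξ` for `x = i (1 + iA)⁻¹ ξ`. -/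
theorem laplace_mem_generatorGraph (hU : IsUnitaryGroup U) (ξ : H) :
    (Complex.I • laplace U ξ, ξ + Complex.I • Complex.I • laplace U ξ) ∈ generatorGraph U := by
  have hd : HasDerivAt (fun x => ∫ s in (0 : ℝ)..x, Real.exp (-s) • U (-s) ξ)
      (Real.exp (-(-0)) • U (-(-0)) ξ) (-0) :=
    intervalIntegral.integral_hasDerivAt_right (by simp)
      ((hU.continuous_exp_neg_smul ξ).stronglyMeasurableAtFilter _ _)
      (hU.continuous_exp_neg_smul ξ).continuousAt
  have hd2 := hd.scomp (0 : ℝ) (hasDerivAt_neg (0 : ℝ))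
  have hexp : HasDerivAt (fun h : ℝ => Real.exp (-h)) (Real.exp (-0) * (-1)) 0 :=
    (hasDerivAt_neg (0 : ℝ)).exp
  have hd3 := (hexp.smul (hd2.const_sub (laplace U ξ))).const_smul Complex.I
  rw [mem_generatorGraph]
  refine (hd3.congr_of_eventuallyEq (Filter.Eventually.of_forall fun h => ?_)).congr_deriv ?_
  · simp only [Pi.smul_apply, map_smul, hU.apply_laplace]
    rfl
  · simp [hU.map_zero, smul_smul]

/-- **Stone's theorem**: every strongly continuous one-parameter unitary group is generated by a
self-adjoint operator. -/
theorem exists_isUnitaryGroupOf (hU : IsUnitaryGroup U) :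
    ∃ A : SelfAdjointOp H, A.IsUnitaryGroupOf U := by
  have hsv : ∀ p ∈ generatorGraph U, p.1 = 0 → p.2 = 0 := by
    rintro ⟨ξ, η⟩ h h0
    simp only at h0
    subst h0
    rw [mem_generatorGraph] at h
    simp only [_root_.map_zero] at h
    simpa using h.unique (hasDerivAt_const (0 : ℝ) (0 : H))
  have hsymm : ∀ p ∈ generatorGraph U, ∀ q ∈ generatorGraph U,
      inner ℂ p.2 q.1 = inner ℂ p.1 q.2 := by
    rintro ⟨ξ, η⟩ h ⟨ξ', η'⟩ h'
    rw [mem_generatorGraph] at h h'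
    have h1 := h.inner ℂ h'
    simp only [hU.inner_apply] at h1
    have h2 := h1.unique (hasDerivAt_const (0 : ℝ) _)
    simp only [hU.map_zero, one_apply_eq_self, inner_smul_left, inner_smul_right,
      Complex.conj_I] at h2
    have h3 : Complex.I * (inner ℂ ξ η' - inner ℂ η ξ') = 0 := by linear_combination h2
    exact (sub_eq_zero.1 ((mul_eq_zero.1 h3).resolve_left Complex.I_ne_zero)).symm
  have hplus : ∀ ξ : H, ∃ x : H, (x, ξ - Complex.I • x) ∈ generatorGraph U := by
    intro ξ
    -- The reversed group has generator `-A`, and `-A - i = -(A + i)`.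
    have h := hU.comp_neg.laplace_mem_generatorGraph (-ξ)
    rw [mem_generatorGraph, ← neg_zero] at h
    refine ⟨Complex.I • laplace (fun t => U (-t)) (-ξ), mem_generatorGraph.2 ?_⟩
    have h2 := h.scomp (0 : ℝ) (hasDerivAt_neg (0 : ℝ))
    refine (h2.congr_of_eventuallyEq (Filter.Eventually.of_forall fun t => ?_)).congr_deriv ?_
    · simp
    · module
  obtain ⟨A, hA⟩ := exists_of_symmetric_graph (generatorGraph U) hsv hsymm
    (fun ξ => ⟨_, hU.laplace_mem_generatorGraph ξ⟩) hplus
  exact ⟨A, hU.mem_unitary, hU.map_zero, hU.map_add, hU.continuous, fun ξ η => by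
    rw [hA, mem_generatorGraph]⟩

end IsUnitaryGroup

theorem isUnitaryGroup_expI (A : SelfAdjointOp H) : IsUnitaryGroup A.expI :=
  A.expI_spec.isUnitaryGroup

theorem expI_injective : Function.Injective (expI : SelfAdjointOp H → ℝ → H →L[ℂ] H) := by
  intro A B h
  refine ext_graph (Submodule.ext fun p => ?_)
  rw [← Prod.mk.eta (p := p), A.expI_spec.mem_graph_iff, B.expI_spec.mem_graph_iff, h]

theorem resolvent_eq_laplace (A : SelfAdjointOp H) (ξ : H) :
    A.resolvent I_im_ne ξ = Complex.I • IsUnitaryGroup.laplace A.expI ξ := by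
  have h := (A.expI_spec.mem_graph_iff _ _).2 (IsUnitaryGroup.mem_generatorGraph.1
    (A.isUnitaryGroup_expI.laplace_mem_generatorGraph ξ))
  obtain ⟨x, hx1, hx2⟩ := (LinearPMap.mem_graph_iff A.1).1 h
  simp only at hx1 hx2
  have h2 := A.resolvent_apply_sub I_im_ne x
  rwa [hx2, hx1, add_sub_cancel_right] at h2

/-! ### Unitary groups and resolvents -/

theorem norm_expI_apply (A : SelfAdjointOp H) (t : ℝ) (ξ : H) : ‖A.expI t ξ‖ = ‖ξ‖ :=
  A.isUnitaryGroup_expI.norm_apply t ξ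

theorem norm_expI_sub_le (A B : SelfAdjointOp H) (t : ℝ) (ξ : H) :
    ‖A.expI t ξ - B.expI t ξ‖ ≤ 2 * ‖ξ‖ := by
  refine (norm_sub_le _ _).trans ?_
  rw [norm_expI_apply, norm_expI_apply, two_mul]

theorem resolvent_mem_graph (A : SelfAdjointOp H) {z : ℂ} (hz : z.im ≠ 0) (ξ : H) :
    (A.resolvent hz ξ, ξ + z • A.resolvent hz ξ) ∈ A.1.graph := by
  obtain ⟨x, hx1, hx2⟩ := A.resolvent_spec hz ξ
  refine (LinearPMap.mem_graph_iff A.1).2 ⟨x, hx1, ?_⟩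
  rw [← hx1, ← hx2]
  simp

theorem resolvent_eq_of_mem_graph (A : SelfAdjointOp H) {z : ℂ} (hz : z.im ≠ 0) {ξ η : H}
    (h : (ξ, η) ∈ A.1.graph) : A.resolvent hz (η - z • ξ) = ξ := by
  obtain ⟨x, hx1, hx2⟩ := (LinearPMap.mem_graph_iff A.1).1 h
  simp only at hx1 hx2
  rw [← hx1, ← hx2, A.resolvent_apply_sub]

theorem norm_resolvent_apply_le (A : SelfAdjointOp H) (ξ : H) :
    ‖A.resolvent I_im_ne ξ‖ ≤ ‖ξ‖ := by
  obtain ⟨x, hx1, hx2⟩ := A.resolvent_spec I_im_ne ξ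
  have h := A.norm_le_sub Complex.I x
  rw [hx2, hx1] at h
  simpa using h

theorem inner_eq_of_mem_graph (A : SelfAdjointOp H) {ξ η ξ' η' : H}
    (h : (ξ, η) ∈ A.1.graph) (h' : (ξ', η') ∈ A.1.graph) :
    inner ℂ η ξ' = inner ℂ ξ η' := by
  obtain ⟨x, hx1, hx2⟩ := (LinearPMap.mem_graph_iff A.1).1 h
  obtain ⟨y, hy1, hy2⟩ := (LinearPMap.mem_graph_iff A.1).1 h'
  simp only at hx1 hx2 hy1 hy2
  rw [← hx1, ← hx2, ← hy1, ← hy2, A.inner_symm]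

theorem resolvent_expI (A : SelfAdjointOp H) {z : ℂ} (hz : z.im ≠ 0) (t : ℝ) (ξ : H) :
    A.resolvent hz (A.expI t ξ) = A.expI t (A.resolvent hz ξ) := by
  have h := (A.expI_spec.hasDerivAt (A.resolvent_mem_graph hz ξ) t).2
  have h2 := A.resolvent_eq_of_mem_graph hz h
  rwa [map_add (A.expI t), map_smul (A.expI t), add_sub_cancel_right] at h2

/-! ### Locally uniform convergence of unitary groups -/

section Close

variable {ι : Type*} (l : Filter ι) (A B : ι → SelfAdjointOp H)

/-- The vectors `ξ` for which `e^{it A_i} ξ - e^{it B_i} ξ` tends to `0` along `l`, uniformly for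
`t` in bounded sets. -/
def locUnifClose : Submodule ℂ H where
  carrier := {ξ | ∀ r : ℝ, ∀ ε > 0, ∀ᶠ i in l, ∀ t : ℝ, |t| ≤ r →
    ‖(A i).expI t ξ - (B i).expI t ξ‖ ≤ ε}
  add_mem' {ξ η} hξ hη r ε hε := by
    filter_upwards [hξ r (ε / 2) (by positivity), hη r (ε / 2) (by positivity)] with i h1 h2 t ht
    rw [map_add, map_add, add_sub_add_comm]
    linarith [norm_add_le ((A i).expI t ξ - (B i).expI t ξ) ((A i).expI t η - (B i).expI t η),
      h1 t ht, h2 t ht]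
  zero_mem' r ε hε := Eventually.of_forall fun i t _ => by simpa using hε.le
  smul_mem' c ξ hξ r ε hε := by
    filter_upwards [hξ r (ε / (‖c‖ + 1)) (by positivity)] with i h1 t ht
    rw [map_smul, map_smul, ← smul_sub, norm_smul]
    have h2 := h1 t ht
    rw [le_div_iff₀ (by positivity)] at h2
    nlinarith [norm_nonneg ((A i).expI t ξ - (B i).expI t ξ)]

variable {l A B}

theorem mem_locUnifClose {ξ : H} : ξ ∈ locUnifClose l A B ↔ ∀ r : ℝ, ∀ ε > 0, ∀ᶠ i in l,
    ∀ t : ℝ, |t| ≤ r → ‖(A i).expI t ξ - (B i).expI t ξ‖ ≤ ε := Iff.rfl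

variable (l A B)

theorem isClosed_locUnifClose : IsClosed (locUnifClose l A B : Set H) := by
  refine isClosed_of_closure_subset fun ξ hξ r ε hε => ?_
  obtain ⟨η, hη, hd⟩ := Metric.mem_closure_iff.1 hξ (ε / 3) (by positivity)
  rw [dist_eq_norm] at hd
  filter_upwards [hη r (ε / 3) (by positivity)] with i h1 t ht
  have e : (A i).expI t ξ - (B i).expI t ξ = (A i).expI t (ξ - η) - (B i).expI t (ξ - η)
      + ((A i).expI t η - (B i).expI t η) := by
    rw [map_sub, map_sub]; abel
  rw [e]
  linarith [norm_add_le ((A i).expI t (ξ - η) - (B i).expI t (ξ - η))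
    ((A i).expI t η - (B i).expI t η), h1 t ht, norm_expI_sub_le (A i) (B i) t (ξ - η)]

variable {l A B}

theorem mem_locUnifClose_of_dense {s : Set H} (hs : Dense (Submodule.span ℂ s : Set H))
    (h : ∀ ξ ∈ s, ξ ∈ locUnifClose l A B) (ξ : H) : ξ ∈ locUnifClose l A B := by
  have h1 : (Submodule.span ℂ s : Set H) ⊆ locUnifClose l A B := Submodule.span_le.2 h
  have h2 := (isClosed_locUnifClose l A B).closure_subset_iff.2 h1
  rw [hs.closure_eq] at h2
  exact h2 trivial

end Close

/-! ### Convergence of groups and convergence of resolvents -/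

/-- Dominated convergence in the Laplace transform formula for the resolvent. -/
theorem tendsto_resolvent_of_locUnifClose {ι : Type*} {l : Filter ι} [l.IsCountablyGenerated]
    {A : ι → SelfAdjointOp H} {B : SelfAdjointOp H}
    (h : ∀ ξ, ξ ∈ locUnifClose l A fun _ => B) (ξ : H) :
    Tendsto (fun i => (A i).resolvent I_im_ne ξ) l (𝓝 (B.resolvent I_im_ne ξ)) := by
  simp only [resolvent_eq_laplace]
  refine Tendsto.const_smul ?_ _
  refine MeasureTheory.tendsto_integral_filter_of_dominated_convergence
    (fun s => Real.exp (-s) * ‖ξ‖) ?_ ?_ ((integrableOn_exp_neg_Ioi 0).mul_const ‖ξ‖) ?_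
  · exact Eventually.of_forall fun i =>
      ((A i).isUnitaryGroup_expI.continuous_exp_neg_smul ξ).aestronglyMeasurable
  · exact Eventually.of_forall fun i => Eventually.of_forall fun s =>
      ((A i).isUnitaryGroup_expI.norm_exp_neg_smul ξ s).le
  · refine Eventually.of_forall fun s => Tendsto.const_smul ?_ _
    refine Metric.tendsto_nhds.2 fun ε hε => ?_
    filter_upwards [h ξ |-s| (ε / 2) (by positivity)] with i hi
    rw [dist_eq_norm]
    linarith [hi (-s) le_rfl]

/-- Pointwise convergence to `0` of equi-Lipschitz maps is uniform on compact sets. -/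
theorem eventually_norm_le_of_isCompact {E F ι : Type*} [NormedAddCommGroup E]
    [NormedAddCommGroup F] {l : Filter ι} {T : ι → E → F} {C : ℝ}
    (hC : ∀ i x y, ‖T i x - T i y‖ ≤ C * ‖x - y‖) (hT : ∀ x, Tendsto (fun i => T i x) l (𝓝 0))
    {K : Set E} (hK : IsCompact K) {ε : ℝ} (hε : 0 < ε) : ∀ᶠ i in l, ∀ x ∈ K, ‖T i x‖ ≤ ε := by
  obtain ⟨s, -, hs, hcov⟩ := hK.finite_cover_balls (e := ε / 2 / (|C| + 1)) (by positivity)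
  have h1 : ∀ᶠ i in l, ∀ y ∈ s, ‖T i y‖ < ε / 2 := (Filter.eventually_all_finite hs).2 fun y _ => by
    simpa using Metric.tendsto_nhds.1 (hT y) (ε / 2) (by positivity)
  filter_upwards [h1] with i hi x hx
  obtain ⟨y, hy, hxy⟩ := Set.mem_iUnion₂.1 (hcov hx)
  rw [mem_ball_iff_norm, lt_div_iff₀ (by positivity)] at hxy
  have h2 := hC i x y
  have h3 : C * ‖x - y‖ ≤ |C| * ‖x - y‖ := by gcongr; exact le_abs_self C
  have h4 := norm_add_le (T i x - T i y) (T i y)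
  rw [sub_add_cancel] at h4
  nlinarith [hi y hy, norm_nonneg (x - y)]

/-- An energy estimate for the intertwining defect
`e(s) = (A - i)⁻¹ e^{isB} (B - i)⁻¹ ξ - e^{isA} (A - i)⁻¹ (B - i)⁻¹ ξ`. It solves
`e' = i A e + i f` with `f(s) = ((A - i)⁻¹ - (B - i)⁻¹) e^{isB} ξ`, and the term `i A e` does not
contribute to the derivative of `‖e‖ ^ 2`. -/
theorem norm_sq_resolvent_expI_sub_le (A B : SelfAdjointOp H) (ξ : H) {r δ : ℝ} (hr : 0 ≤ r)
    (hδ : ∀ s : ℝ, |s| ≤ r →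
      ‖A.resolvent I_im_ne (B.expI s ξ) - B.resolvent I_im_ne (B.expI s ξ)‖ ≤ δ)
    {t : ℝ} (ht : |t| ≤ r) :
    ‖A.resolvent I_im_ne (B.expI t (B.resolvent I_im_ne ξ))
      - A.expI t (A.resolvent I_im_ne (B.resolvent I_im_ne ξ))‖ ^ 2 ≤ 4 * ‖ξ‖ * δ * r := by
  set RA := A.resolvent I_im_ne with hRA
  set RB := B.resolvent I_im_ne with hRB
  set e : ℝ → H := fun s => RA (B.expI s (RB ξ)) - A.expI s (RA (RB ξ)) with he
  set f : ℝ → H := fun s => RA (B.expI s ξ) - RB (B.expI s ξ) with hf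
  have hnorm : ∀ s, ‖e s‖ ≤ 2 * ‖ξ‖ := fun s => by
    have h1 := norm_sub_le (RA (B.expI s (RB ξ))) (A.expI s (RA (RB ξ)))
    have h2 := A.norm_resolvent_apply_le (B.expI s (RB ξ))
    have h3 := A.norm_resolvent_apply_le (RB ξ)
    have h4 := B.norm_resolvent_apply_le ξ
    rw [norm_expI_apply] at h1 h2
    simp only [he]
    linarith
  have hgraph : ∀ s, ∃ v, (e s, v) ∈ A.1.graph ∧
      HasDerivAt e (Complex.I • v + Complex.I • f s) s := fun s => by
    obtain ⟨hA1, hA2⟩ := A.expI_spec.hasDerivAt (A.resolvent_mem_graph I_im_ne (RB ξ)) s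
    have hB1 := (B.expI_spec.hasDerivAt (B.resolvent_mem_graph I_im_ne ξ) s).1
    have hB2 := (RA.restrictScalars ℝ).hasFDerivAt.comp_hasDerivAt s hB1
    refine ⟨_, sub_mem (A.resolvent_mem_graph I_im_ne (B.expI s (RB ξ))) hA2,
      (hB2.sub hA1).congr_deriv ?_⟩
    simp only [hf, hRB, resolvent_expI]
    simp only [← hRA, ← hRB, ContinuousLinearMap.coe_restrictScalars', map_add, map_smul]
    module
  have hder : ∀ s, HasDerivAt (fun s => (inner ℂ (e s) (e s) : ℂ))
      (inner ℂ (e s) (Complex.I • f s) + inner ℂ (Complex.I • f s) (e s)) s := fun s => by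
    obtain ⟨v, hv, hd⟩ := hgraph s
    refine (hd.inner ℂ hd).congr_deriv ?_
    have h := A.inner_eq_of_mem_graph hv hv
    simp only [inner_add_left, inner_add_right, inner_smul_left, inner_smul_right, h,
      Complex.conj_I]
    ring
  have hmv := (convex_Icc (-r) r).norm_image_sub_le_of_norm_hasDerivWithin_le
    (C := 4 * ‖ξ‖ * δ) (fun s _ => (hder s).hasDerivWithinAt) (fun s hs => by
      have hfs := hδ s (abs_le.2 hs)
      have h1 := norm_add_le (inner ℂ (e s) (Complex.I • f s)) (inner ℂ (Complex.I • f s) (e s))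
      have h2 := norm_inner_le_norm (𝕜 := ℂ) (e s) (Complex.I • f s)
      have h3 := norm_inner_le_norm (𝕜 := ℂ) (Complex.I • f s) (e s)
      rw [norm_smul, Complex.norm_I, one_mul] at h2 h3
      have h4 : ‖e s‖ * ‖f s‖ ≤ 2 * ‖ξ‖ * δ :=
        mul_le_mul (hnorm s) hfs (norm_nonneg _) (by positivity)
      linarith) (x := 0) (y := t) ⟨by linarith, hr⟩ (abs_le.1 ht)
  have he0 : e 0 = 0 := by
    simp [he, A.expI_spec.map_zero, B.expI_spec.map_zero]
  have hδ0 : 0 ≤ δ := (norm_nonneg _).trans (hδ t ht)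
  rw [he0, inner_zero_left, sub_zero, sub_zero, inner_self_eq_norm_sq_to_K, Real.norm_eq_abs] at hmv
  have h5 : ‖((‖e t‖ : ℂ)) ^ 2‖ = ‖e t‖ ^ 2 := by simp
  change ‖((‖e t‖ : ℂ)) ^ 2‖ ≤ _ at hmv
  rw [h5] at hmv
  exact hmv.trans (by gcongr)

/-- Strong resolvent convergence implies convergence of the unitary groups, uniformly for bounded
times. -/
theorem locUnifClose_of_tendsto_resolvent {ι : Type*} {l : Filter ι}
    {A : ι → SelfAdjointOp H} {B : SelfAdjointOp H}
    (h : ∀ ξ, Tendsto (fun i => (A i).resolvent I_im_ne ξ) l (𝓝 (B.resolvent I_im_ne ξ))) (ξ : H) :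
    ξ ∈ locUnifClose l A fun _ => B := by
  have hd := B.denseRange_resolvent I_im_ne
  have hd2 : DenseRange fun ξ => B.resolvent I_im_ne (B.resolvent I_im_ne ξ) :=
    hd.comp hd (B.resolvent I_im_ne).continuous
  refine mem_locUnifClose_of_dense (hd2.mono Submodule.subset_span) ?_ ξ
  rintro _ ⟨ξ, rfl⟩ r ε hε
  have hcpt : ∀ (η : H) {δ : ℝ}, 0 < δ → ∀ᶠ i in l, ∀ s : ℝ, |s| ≤ |r| →
      ‖(A i).resolvent I_im_ne (B.expI s η) - B.resolvent I_im_ne (B.expI s η)‖ ≤ δ := by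
    intro η δ hδ
    have hK : IsCompact ((fun s => B.expI s η) '' Set.Icc (-|r|) |r|) :=
      isCompact_Icc.image (B.expI_spec.continuous η)
    have := eventually_norm_le_of_isCompact (l := l) (C := 2)
      (T := fun i x => (A i).resolvent I_im_ne x - B.resolvent I_im_ne x)
      (fun i x y => by
        rw [sub_sub_sub_comm, ← map_sub, ← map_sub]
        linarith [norm_sub_le ((A i).resolvent I_im_ne (x - y)) (B.resolvent I_im_ne (x - y)),
          (A i).norm_resolvent_apply_le (x - y), B.norm_resolvent_apply_le (x - y)])
      (fun x => tendsto_sub_nhds_zero_iff.2 (h x)) hK hδ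
    filter_upwards [this] with i hi s hs
    exact hi _ ⟨s, abs_le.1 hs, rfl⟩
  -- This `δ` makes the bound `4 * ‖ξ‖ * δ * |r|` of the energy estimate at most `(ε / 3) ^ 2`.
  set δ := (ε / 3) ^ 2 / (4 * ‖ξ‖ * |r| + 1) with hδ
  have hδ0 : 0 < δ := by positivity
  filter_upwards [hcpt ξ hδ0, hcpt (B.resolvent I_im_ne ξ) (δ := ε / 3) (by positivity)]
    with i h1 h2 t ht
  have ht' := ht.trans (le_abs_self r)
  have h3 := norm_sq_resolvent_expI_sub_le (A i) B ξ (abs_nonneg r) h1 ht'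
  have h4 : 4 * ‖ξ‖ * δ * |r| ≤ (ε / 3) ^ 2 := by
    have : δ * (4 * ‖ξ‖ * |r| + 1) = (ε / 3) ^ 2 := by rw [hδ]; field_simp
    nlinarith
  have h5 := abs_le_of_sq_le_sq (h3.trans h4) (by positivity)
  rw [abs_norm] at h5
  -- At time `0` the bound `h2` compares `(A - i)⁻¹ (B - i)⁻¹ ξ` with `(B - i)⁻² ξ`.
  have h6 := h2 0 (by simp)
  have h7 := h2 t ht'
  rw [B.expI_spec.map_zero, one_apply_eq_self] at h6
  rw [← (A i).norm_expI_apply t, map_sub] at h6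
  rw [resolvent_expI B] at h7
  set a := (A i).expI t ((A i).resolvent I_im_ne (B.resolvent I_im_ne ξ))
  set c := (A i).resolvent I_im_ne (B.expI t (B.resolvent I_im_ne ξ))
  rw [norm_sub_rev] at h6 h5
  linarith [norm_sub_le_norm_sub_add_norm_sub
    ((A i).expI t (B.resolvent I_im_ne (B.resolvent I_im_ne ξ))) a
      (B.expI t (B.resolvent I_im_ne (B.resolvent I_im_ne ξ))), norm_sub_le_norm_sub_add_norm_sub
    a c (B.expI t (B.resolvent I_im_ne (B.resolvent I_im_ne ξ)))]

/-! ### Limits of Cauchy sequences -/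

section Sequence

variable {u : ℕ → SelfAdjointOp H}

theorem cauchySeq_expI_apply
    (hu : ∀ ξ, ξ ∈ locUnifClose atTop (fun p : ℕ × ℕ => u p.1) fun p => u p.2) (t : ℝ) (ξ : H) :
    CauchySeq fun k => (u k).expI t ξ := by
  refine Metric.cauchySeq_iff.2 fun ε hε => ?_
  obtain ⟨N, hN⟩ := eventually_atTop_prod_self.1 (hu ξ |t| (ε / 2) (by positivity))
  refine ⟨N, fun m hm n hn => ?_⟩
  rw [dist_eq_norm]
  linarith [hN m n hm hn t le_rfl]

/-- The pointwise limit of the unitary groups is a strongly continuous unitary group, hence has a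
self-adjoint generator by Stone's theorem. -/
theorem exists_locUnifClose_of_cauchy
    (hu : ∀ ξ, ξ ∈ locUnifClose atTop (fun p : ℕ × ℕ => u p.1) fun p => u p.2) :
    ∃ A : SelfAdjointOp H, ∀ ξ, ξ ∈ locUnifClose atTop u fun _ => A := by
  choose g hg using fun t ξ => cauchySeq_tendsto_of_complete (cauchySeq_expI_apply hu t ξ)
  let U : ℝ → H →L[ℂ] H := fun t =>
    continuousLinearMapOfTendsto (fun k => (u k).expI t) (tendsto_pi_nhds.2 (hg t))
  have hU : ∀ t ξ, Tendsto (fun k => (u k).expI t ξ) atTop (𝓝 (U t ξ)) := hg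
  have hclose : ∀ ξ (r : ℝ), ∀ ε > 0, ∀ᶠ k in atTop, ∀ t : ℝ, |t| ≤ r →
      ‖(u k).expI t ξ - U t ξ‖ ≤ ε := fun ξ r ε hε => by
    obtain ⟨N, hN⟩ := eventually_atTop_prod_self.1 (hu ξ r ε hε)
    filter_upwards [eventually_ge_atTop N] with k hk t ht
    refine le_of_tendsto ((hU t ξ).const_sub ((u k).expI t ξ)).norm ?_
    filter_upwards [eventually_ge_atTop N] with j hj
    exact hN k j hk hj t ht
  have hnorm : ∀ t ξ, ‖U t ξ‖ = ‖ξ‖ := fun t ξ =>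
    tendsto_nhds_unique (hU t ξ).norm (by simp only [norm_expI_apply]; exact tendsto_const_nhds)
  have h0 : U 0 = 1 := by
    ext ξ
    refine tendsto_nhds_unique (hU 0 ξ) ?_
    simp only [(u _).expI_spec.map_zero]
    exact tendsto_const_nhds
  have hadd : ∀ s t, U (s + t) = U s * U t := fun s t => by
    ext ξ
    refine tendsto_nhds_unique (hU (s + t) ξ) ?_
    have h1 : Tendsto (fun k => (u k).expI s ((u k).expI t ξ - U t ξ)) atTop (𝓝 0) := by
      rw [tendsto_zero_iff_norm_tendsto_zero]
      simp only [norm_expI_apply]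
      exact tendsto_iff_norm_sub_tendsto_zero.1 (hU t ξ)
    have h2 := h1.add (hU s (U t ξ))
    rw [zero_add] at h2
    refine h2.congr fun k => ?_
    rw [map_sub, sub_add_cancel, (u k).expI_spec.map_add, mul_apply_eq_comp]
  have hunit : ∀ t, U t ∈ unitary (H →L[ℂ] H) := fun t => by
    have hi : star (U t) * U t = 1 :=
      (ContinuousLinearMap.norm_map_iff_adjoint_comp_self (U t)).1 (hnorm t)
    have h1 : U t * U (-t) = 1 := by rw [← hadd, add_neg_cancel, h0]
    refine Unitary.mem_iff.2 ⟨hi, ?_⟩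
    have : star (U t) = U (-t) := by
      rw [← mul_one (star (U t)), ← h1, ← mul_assoc, hi, one_mul]
    rw [this, h1]
  have hcont : ∀ ξ, Continuous fun t => U t ξ := fun ξ => by
    have hloc : TendstoLocallyUniformly (fun k t => (u k).expI t ξ) (fun t => U t ξ) atTop := by
      refine Metric.tendstoLocallyUniformly_iff.2 fun ε hε t => ?_
      refine ⟨Metric.ball t 1, Metric.ball_mem_nhds t one_pos, ?_⟩
      filter_upwards [hclose ξ (|t| + 1) (ε / 2) (by positivity)] with k hk s hs
      rw [Metric.mem_ball, Real.dist_eq] at hs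
      have h1 : |s| ≤ |t| + 1 := by
        have := abs_sub_abs_le_abs_sub s t
        linarith
      rw [dist_eq_norm, norm_sub_rev]
      linarith [hk s h1]
    exact hloc.continuous (Frequently.of_forall fun k => (u k).expI_spec.continuous ξ)
  obtain ⟨A, hA⟩ := IsUnitaryGroup.exists_isUnitaryGroupOf ⟨hunit, h0, hadd, hcont⟩
  have hAU : A.expI = U := A.expI_spec.unique hA
  refine ⟨A, fun ξ => ?_⟩
  rw [mem_locUnifClose, hAU]
  exact hclose ξ

end Sequence

/-! ### The metric -/

section Metric

/-- The `m`-th supremum `sup_{t ∈ [-(m+1), m+1]} ‖e^{itA} ξ - e^{itB} ξ‖` in `expDist`. -/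
noncomputable def expSup (m : ℕ) (ξ : H) (A B : SelfAdjointOp H) : ℝ :=
  ⨆ t : Set.Icc (-((m + 1 : ℕ) : ℝ)) ((m + 1 : ℕ) : ℝ), ‖A.expI t ξ - B.expI t ξ‖

theorem expSup_nonneg (m : ℕ) (ξ : H) (A B : SelfAdjointOp H) : 0 ≤ expSup m ξ A B :=
  Real.iSup_nonneg fun _ => norm_nonneg _

theorem le_expSup {m : ℕ} (ξ : H) (A B : SelfAdjointOp H) {t : ℝ} (ht : |t| ≤ (m + 1 : ℕ)) :
    ‖A.expI t ξ - B.expI t ξ‖ ≤ expSup m ξ A B :=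
  le_ciSup (f := fun t : Set.Icc (-((m + 1 : ℕ) : ℝ)) ((m + 1 : ℕ) : ℝ) =>
    ‖A.expI t ξ - B.expI t ξ‖) ⟨2 * ‖ξ‖, by rintro _ ⟨s, rfl⟩; exact norm_expI_sub_le A B s ξ⟩
    ⟨t, abs_le.1 ht⟩

theorem expSup_le {m : ℕ} {ξ : H} {A B : SelfAdjointOp H} {c : ℝ} (hc : 0 ≤ c)
    (h : ∀ t : ℝ, |t| ≤ (m + 1 : ℕ) → ‖A.expI t ξ - B.expI t ξ‖ ≤ c) : expSup m ξ A B ≤ c :=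
  Real.iSup_le (fun t => h t (abs_le.2 t.2)) hc

theorem expSup_self (m : ℕ) (ξ : H) (A : SelfAdjointOp H) : expSup m ξ A A = 0 := by
  simp [expSup]

theorem expSup_comm (m : ℕ) (ξ : H) (A B : SelfAdjointOp H) :
    expSup m ξ A B = expSup m ξ B A := by
  simp only [expSup, norm_sub_rev]

theorem expSup_triangle (m : ℕ) (ξ : H) (A B C : SelfAdjointOp H) :
    expSup m ξ A C ≤ expSup m ξ A B + expSup m ξ B C :=
  expSup_le (add_nonneg (expSup_nonneg _ _ _ _) (expSup_nonneg _ _ _ _)) fun t ht =>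
    (norm_sub_le_norm_sub_add_norm_sub _ (B.expI t ξ) _).trans
      (add_le_add (le_expSup ξ A B ht) (le_expSup ξ B C ht))

/-- The weight `2^{-(n+m)}` in `expDist`, with both indices shifted by one. -/
noncomputable def expWeight (p : ℕ × ℕ) : ℝ := 1 / 2 ^ ((p.1 + 1) + (p.2 + 1))

theorem expWeight_pos (p : ℕ × ℕ) : 0 < expWeight p := by
  unfold expWeight; positivity

theorem summable_expWeight : Summable expWeight := by
  have h : Summable fun n : ℕ => (1 / 2 : ℝ) ^ (n + 1) :=
    (summable_nat_add_iff 1).2 summable_geometric_two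
  refine (h.mul_of_nonneg h (fun n => by positivity) fun n => by positivity).congr fun p => ?_
  rw [expWeight, ← pow_add, one_div_pow]

variable (b : HilbertBasis ℕ ℂ H)

theorem expWeight_mul_expSup_nonneg (A B : SelfAdjointOp H) (p : ℕ × ℕ) :
    0 ≤ expWeight p * expSup p.2 (b p.1) A B :=
  mul_nonneg (expWeight_pos p).le (expSup_nonneg _ _ _ _)

theorem expWeight_mul_expSup_le (A B : SelfAdjointOp H) (p : ℕ × ℕ) :
    expWeight p * expSup p.2 (b p.1) A B ≤ expWeight p * 2 := by
  refine mul_le_mul_of_nonneg_left (expSup_le two_pos.le fun t _ => ?_) (expWeight_pos p).le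
  have h := norm_expI_sub_le A B t (b p.1)
  rwa [b.orthonormal.1, mul_one] at h

theorem summable_expWeight_mul_expSup (A B : SelfAdjointOp H) :
    Summable fun p : ℕ × ℕ => expWeight p * expSup p.2 (b p.1) A B :=
  (summable_expWeight.mul_right 2).of_nonneg_of_le (expWeight_mul_expSup_nonneg b A B)
    (expWeight_mul_expSup_le b A B)

theorem expDist_eq_tsum_prod (A B : SelfAdjointOp H) :
    expDist b A B = ∑' p : ℕ × ℕ, expWeight p * expSup p.2 (b p.1) A B :=
  (summable_expWeight_mul_expSup b A B).tsum_prod.symm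

theorem expWeight_mul_expSup_le_expDist (A B : SelfAdjointOp H) (n m : ℕ) :
    expWeight (n, m) * expSup m (b n) A B ≤ expDist b A B := by
  rw [expDist_eq_tsum_prod]
  exact (summable_expWeight_mul_expSup b A B).le_tsum (n, m)
    fun p _ => expWeight_mul_expSup_nonneg b A B p

/-- The distances tend to `0` if and only if the unitary groups approach each other on every vector,
uniformly for bounded times. -/
theorem tendsto_expDist_iff {ι : Type*} {l : Filter ι} {A B : ι → SelfAdjointOp H} :
    Tendsto (fun i => expDist b (A i) (B i)) l (𝓝 0) ↔ ∀ ξ, ξ ∈ locUnifClose l A B := by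
  constructor
  · intro h
    have hs : Dense (Submodule.span ℂ (Set.range b) : Set H) :=
      Submodule.dense_iff_topologicalClosure_eq_top.2 b.dense_span
    refine mem_locUnifClose_of_dense hs ?_
    rintro _ ⟨n, rfl⟩ r ε hε
    obtain ⟨m, hm⟩ := exists_nat_ge r
    have hw := expWeight_pos (n, m)
    filter_upwards [h.eventually_lt_const (mul_pos hw hε)] with i hi t ht
    have h1 := (expWeight_mul_expSup_le_expDist b (A i) (B i) n m).trans_lt hi
    refine (le_expSup (m := m) (b n) (A i) (B i) ?_).trans (lt_of_mul_lt_mul_left h1 hw.le).le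
    push_cast
    linarith
  · intro h
    simp only [expDist_eq_tsum_prod]
    have h0 : (0 : ℝ) = ∑' _ : ℕ × ℕ, (0 : ℝ) := tsum_zero.symm
    rw [h0]
    refine tendsto_tsum_of_dominated_convergence (summable_expWeight.mul_right 2) (fun p => ?_) ?_
    · rw [← mul_zero (expWeight p)]
      refine Tendsto.const_mul _ (Metric.tendsto_nhds.2 fun ε hε => ?_)
      filter_upwards [h (b p.1) ((p.2 + 1 : ℕ) : ℝ) (ε / 2) (by positivity)] with i hi
      rw [Real.dist_0_eq_abs, abs_of_nonneg (expSup_nonneg _ _ _ _)]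
      linarith [expSup_le (by positivity) hi]
    · exact Eventually.of_forall fun i p => by
        rw [Real.norm_eq_abs, abs_of_nonneg (expWeight_mul_expSup_nonneg b _ _ p)]
        exact expWeight_mul_expSup_le b _ _ p

theorem eq_of_expDist_eq_zero {A B : SelfAdjointOp H} (h : expDist b A B = 0) : A = B := by
  have h1 := (tendsto_expDist_iff b (l := (⊤ : Filter Unit)) (A := fun _ => A)
    (B := fun _ => B)).1 (by rw [h]; exact tendsto_const_nhds)
  refine expI_injective (funext fun t => ContinuousLinearMap.ext fun ξ => ?_)
  refine sub_eq_zero.1 (norm_le_zero_iff.1 (le_of_forall_gt_imp_ge_of_dense fun ε hε => ?_))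
  exact (h1 ξ |t| ε hε).exists.choose_spec t le_rfl

/-- The metric space structure on `SA(H)` with distance `expDist b` and the uniformity defined by
it. -/
noncomputable abbrev expMetricSpace : MetricSpace (SelfAdjointOp H) where
  dist := expDist b
  dist_self A := by simp [expDist_eq_tsum_prod, expSup_self]
  dist_comm A B := by simp only [expDist_eq_tsum_prod, expSup_comm _ _ A B]
  dist_triangle A B C := by
    simp only [expDist_eq_tsum_prod]
    rw [← (summable_expWeight_mul_expSup b A B).tsum_add (summable_expWeight_mul_expSup b B C)]
    refine (summable_expWeight_mul_expSup b A C).tsum_le_tsum (fun p => ?_)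
      ((summable_expWeight_mul_expSup b A B).add (summable_expWeight_mul_expSup b B C))
    rw [← mul_add]
    exact mul_le_mul_of_nonneg_left (expSup_triangle _ _ _ _ _) (expWeight_pos p).le
  eq_of_dist_eq_zero h := eq_of_expDist_eq_zero b h

end Metric

/-! ### The strong resolvent topology -/

theorem tendsto_nhds_iff_resolvent {ι : Type*} {l : Filter ι} {A : ι → SelfAdjointOp H}
    {B : SelfAdjointOp H} : Tendsto A l (𝓝 B) ↔
      ∀ ξ, Tendsto (fun i => (A i).resolvent I_im_ne ξ) l (𝓝 (B.resolvent I_im_ne ξ)) := by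
  simp only [nhds_iInf, tendsto_iInf, nhds_induced, tendsto_comap_iff,
    Function.comp_def]

/-- The neighbourhoods in the strong resolvent topology are those of the metric `expDist b`. -/
theorem nhds_eq_comap_expDist (b : HilbertBasis ℕ ℂ H) (A : SelfAdjointOp H) :
    𝓝 A = comap (fun B => expDist b B A) (𝓝 0) := by
  apply le_antisymm
  · rw [← tendsto_iff_comap, tendsto_expDist_iff b (A := fun B => B) (B := fun _ => A)]
    exact locUnifClose_of_tendsto_resolvent (tendsto_nhds_iff_resolvent.1 tendsto_id)
  · rw [← tendsto_id', tendsto_nhds_iff_resolvent]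
    exact tendsto_resolvent_of_locUnifClose ((tendsto_expDist_iff b).1 tendsto_comap)

theorem expMetricSpace_topology (b : HilbertBasis ℕ ℂ H) :
    (expMetricSpace b).toUniformSpace.toTopologicalSpace = strongResolventTopology := by
  refine TopologicalSpace.ext_nhds fun A => ?_
  rw [nhds_eq_comap_expDist b]
  exact (@nhds_comap_dist _ (expMetricSpace b).toPseudoMetricSpace A).symm

theorem completeSpace_expMetricSpace (b : HilbertBasis ℕ ℂ H) :
    @CompleteSpace (SelfAdjointOp H) (expMetricSpace b).toUniformSpace := by
  refine @Metric.complete_of_cauchySeq_tendsto _ (expMetricSpace b).toPseudoMetricSpace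
    fun u hu => ?_
  have h1 : Tendsto (fun p : ℕ × ℕ => expDist b (u p.1) (u p.2)) atTop (𝓝 0) :=
    (@cauchySeq_iff_tendsto_dist_atTop_0 _ _ (expMetricSpace b).toPseudoMetricSpace _ _ u).1 hu
  obtain ⟨A, hA⟩ := exists_locUnifClose_of_cauchy ((tendsto_expDist_iff b).1 h1)
  exact ⟨A, (@tendsto_iff_dist_tendsto_zero _ _ (expMetricSpace b).toPseudoMetricSpace _ _ _).2
    ((tendsto_expDist_iff b).2 hA)⟩

/-- As the resolvents are contractions, countably many vectors suffice to induce the topology. -/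
theorem isInducing_resolvent_of_denseRange {v : ℕ → H} (hv : DenseRange v) :
    IsInducing fun (A : SelfAdjointOp H) n => A.resolvent I_im_ne (v n) := by
  refine isInducing_iff_nhds.2 fun A => le_antisymm ?_ ?_
  · rw [← tendsto_iff_comap, tendsto_pi_nhds]
    exact fun n => tendsto_nhds_iff_resolvent.1 tendsto_id (v n)
  · rw [← tendsto_id', tendsto_nhds_iff_resolvent]
    intro ξ
    refine Metric.tendsto_nhds.2 fun ε hε => ?_
    obtain ⟨n, hn⟩ := hv.exists_dist_lt ξ (ε := ε / 3) (by positivity)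
    have h1 := tendsto_pi_nhds.1 (tendsto_comap
      (f := fun (A : SelfAdjointOp H) n => A.resolvent I_im_ne (v n))
      (x := 𝓝 fun n => A.resolvent I_im_ne (v n))) n
    filter_upwards [Metric.tendsto_nhds.1 h1 (ε / 3) (by positivity)] with B hB
    rw [dist_eq_norm] at hn hB ⊢
    have e : B.resolvent I_im_ne ξ - A.resolvent I_im_ne ξ = B.resolvent I_im_ne (ξ - v n)
        - A.resolvent I_im_ne (ξ - v n)
        + (B.resolvent I_im_ne (v n) - A.resolvent I_im_ne (v n)) := by
      rw [map_sub, map_sub]; abel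
    change ‖B.resolvent I_im_ne ξ - A.resolvent I_im_ne ξ‖ < ε
    rw [e]
    linarith [norm_add_le (B.resolvent I_im_ne (ξ - v n) - A.resolvent I_im_ne (ξ - v n))
      (B.resolvent I_im_ne (v n) - A.resolvent I_im_ne (v n)),
      norm_sub_le (B.resolvent I_im_ne (ξ - v n)) (A.resolvent I_im_ne (ξ - v n)),
      B.norm_resolvent_apply_le (ξ - v n), A.norm_resolvent_apply_le (ξ - v n)]

theorem secondCountableTopology [TopologicalSpace.SeparableSpace H] :
    SecondCountableTopology (SelfAdjointOp H) := by
  have := UniformSpace.secondCountable_of_separable H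
  exact (isInducing_resolvent_of_denseRange
    (TopologicalSpace.denseRange_denseSeq H)).secondCountableTopology

end SelfAdjointOp

/-! ### Hilbert bases of separable spaces -/

theorem Orthonormal.countable {𝕜 E ι : Type*} [RCLike 𝕜] [NormedAddCommGroup E]
    [InnerProductSpace 𝕜 E] [TopologicalSpace.SeparableSpace E] {v : ι → E}
    (hv : Orthonormal 𝕜 v) : Countable ι := by
  refine Pairwise.countable_of_isOpen_disjoint (s := fun i => Metric.ball (v i) (1 / 2))
    (fun i j hij => Metric.ball_disjoint_ball ?_) (fun i => Metric.isOpen_ball)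
    fun i => ⟨v i, Metric.mem_ball_self (by norm_num)⟩
  -- Distinct members of `v` are at distance `√2`.
  have h1 := norm_sub_sq (𝕜 := 𝕜) (v i) (v j)
  rw [hv.1, hv.1, hv.2 hij, map_zero] at h1
  rw [dist_eq_norm]
  nlinarith [norm_nonneg (v i - v j)]

theorem exists_hilbertBasis_nat {𝕜 E : Type*} [RCLike 𝕜] [NormedAddCommGroup E]
    [InnerProductSpace 𝕜 E] [CompleteSpace E] [TopologicalSpace.SeparableSpace E]
    (hE : ¬ FiniteDimensional 𝕜 E) : Nonempty (HilbertBasis ℕ 𝕜 E) := by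
  obtain ⟨w, b, -⟩ := exists_hilbertBasis 𝕜 E
  have hc : Countable w := b.orthonormal.countable
  have hi : Infinite w := by
    refine not_finite_iff_infinite.1 fun hf => hE ?_
    have := Fintype.ofFinite w
    exact b.toOrthonormalBasis.toBasis.finiteDimensional_of_finite
  obtain ⟨e⟩ : Nonempty (ℕ ≃ w) := nonempty_equiv_of_countable
  refine ⟨HilbertBasis.mk (b.orthonormal.comp e e.injective) ?_⟩
  rw [e.surjective.range_comp, b.dense_span]

/-! ### The space of self-adjoint operators is Polish -/

theorem mainTheorem11 (H : Type*) [NormedAddCommGroup H] [InnerProductSpace ℂ H]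
    [CompleteSpace H] [TopologicalSpace.SeparableSpace H] (hH : ¬ FiniteDimensional ℂ H) :
    (∀ b : HilbertBasis ℕ ℂ H, ∃ M : MetricSpace (SelfAdjointOp H),
      (∀ A B : SelfAdjointOp H, M.dist A B = SelfAdjointOp.expDist b A B) ∧
      M.toUniformSpace.toTopologicalSpace = SelfAdjointOp.strongResolventTopology ∧
      @CompleteSpace (SelfAdjointOp H) M.toUniformSpace) ∧
    TopologicalSpace.SeparableSpace (SelfAdjointOp H) ∧
    PolishSpace (SelfAdjointOp H) := by
  have h2 : SecondCountableTopology (SelfAdjointOp H) := SelfAdjointOp.secondCountableTopology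
  refine ⟨fun b => ⟨SelfAdjointOp.expMetricSpace b, fun _ _ => rfl,
    SelfAdjointOp.expMetricSpace_topology b, SelfAdjointOp.completeSpace_expMetricSpace b⟩,
    inferInstance, ?_⟩
  obtain ⟨b⟩ := exists_hilbertBasis_nat hH
  exact { toSecondCountableTopology := h2
          complete := ⟨SelfAdjointOp.expMetricSpace b, SelfAdjointOp.expMetricSpace_topology b,
            SelfAdjointOp.completeSpace_expMetricSpace b⟩ }
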